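/- For real $s$ and $x$ let $F_s(x)=\sum_{k=1}^{\infty} e^{i\pi k^2x}/k^s$ (convergence meaning convergence of the partial sums). Put $\rho=e^{i\pi/4}$, let $\sigma(x)$ be the sign of $x$, and let powers of complex numbers be principal. For $s\ge 0$ and $x>0$ set $$I_s(x)=\int_{1/2-\rho\infty}^{1/2+\rho\infty}\frac{e^{i\pi z^2x}}{z^s(1-e^{2i\pi z})}\,dz+\rho x^s\int_{-\infty}^{\infty}e^{-\pi xu^2}\sum_{k=1}^{\infty}e^{-i\pi k^2/x}\Big(\frac1{(\rho xu+k)^s}-\frac1{k^s}\Big)du,$$ the first integral being along a straight line, and let $\Omega_s(x)=I_s(x)$ if $x>0$, $\Omega_s(x)=\overline{I_s(-x)}$ if $x<0$. For $x\neq0$ let $T(x)\in[-1,1)$ be the representative of $-1/x$ modulo $2$, and let $T^j$ be the $j$-th iterate of $T$. For irrational $x$ let $(Q_n)_{n\ge0}$ be the denominators of the convergents of the regular continued fraction of $x$, and let $\mu(x)\in[1,\infty]$ be its irrationality exponent, the supremum of the $\mu\ge1$ such that for infinitely many integers $q\geq 1$ there is an integer $p$ with $|x-p/q|<q^{-\mu}$.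 (i) Let $1/2<s<1$. If $x\in(-1,1)$ is irrational and $$\sum_{n=1}^{\infty}\frac{Q_{n+1}^{(3-s)/2}}{Q_n^{1+s/2}}\qquad(1)$$ converges, then $F_s(x)$ converges and $$F_s(x)=\sum_{j=0}^{\infty}e^{i\frac{\pi}{4}\sum_{\ell=0}^{j-1}\sigma(T^\ell(x))}\,|xT(x)\cdots T^{j-1}(x)|^{s-\frac12}\,\Omega_s(T^j(x)),$$ the series on the right being convergent. The series (1) converges for every irrational $x$ such that $\mu(x)<1+\frac{2+s}{3-s}$. (ii) If $x\in(-1,1)$ is irrational and $$\sum_{n=1}^{\infty}\left(\frac{\log(Q_{n+1})}{\sqrt{Q_{n-1}}}+\frac{Q_{n+1}\log(Q_{n+1})^2}{Q_n^{3/2}}\right)\qquad(2)$$ converges, then $F_1(x)$ converges and $$F_1(x)=\sum_{j=0}^{\infty}e^{i\frac{\pi}{4}\sum_{\ell=0}^{j-1}\sigma(T^\ell(x))}\,\sqrt{|xT(x)\cdots T^{j-1}(x)|}\;\Omega_1(T^j(x)),$$ the series on the right being convergent. The series (2) converges for every irrational $x$ such that $\mu(x)<\frac52$. -/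

import Mathlib

open Filter Topology

noncomputable section

namespace ThetaSeries

/-- The `N`-th partial sum `∑_{k=1}^N e^{iπk²x} / k^s` of `F_s(x)`. -/
def partialF (s x : ℝ) (N : ℕ) : ℂ :=
  ∑ k ∈ Finset.Icc 1 N,
    Complex.exp (Complex.I * Real.pi * (k : ℂ) ^ 2 * x) / (((k : ℝ) ^ s : ℝ) : ℂ)

/-- `ρ = e^{iπ/4}`. -/
def rho : ℂ := Complex.exp (Complex.I * (Real.pi / 4))

/-- The integral of `e^{iπz²x} / (z^s (1 - e^{2iπz}))` along the straight line from `1/2 - ρ∞`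
to `1/2 + ρ∞`, parametrised by `z = 1/2 + ρu`, `u ∈ ℝ`. Powers are principal. -/
def lineIntegral (s x : ℝ) : ℂ :=
  ∫ u : ℝ,
    Complex.exp (Complex.I * Real.pi * (1 / 2 + rho * u) ^ 2 * x) /
      ((1 / 2 + rho * u) ^ (s : ℂ) *
        (1 - Complex.exp (2 * Complex.I * Real.pi * (1 / 2 + rho * u)))) * rho

/-- `∑_{k ≥ 1} e^{-iπk²/x} (1 / (ρxu + k)^s - 1 / k^s)`, an absolutely convergent series
(the summation index is `k = m + 1`). -/
def innerSeries (s x u : ℝ) : ℂ :=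
  ∑' m : ℕ,
    Complex.exp (-(Complex.I * Real.pi * ((m : ℂ) + 1) ^ 2 / x)) *
      (1 / (rho * x * u + ((m : ℂ) + 1)) ^ (s : ℂ) - 1 / ((m : ℂ) + 1) ^ (s : ℂ))

/-- `I_s(x)`, for `x > 0`. -/
def Ipos (s x : ℝ) : ℂ :=
  lineIntegral s x +
    rho * ((x ^ s : ℝ) : ℂ) *
      ∫ u : ℝ, ((Real.exp (-(Real.pi * x * u ^ 2)) : ℝ) : ℂ) * innerSeries s x u

/-- `Ω_s(x)`, for `x ≠ 0`: it is `I_s(x)` if `x > 0` and the conjugate of `I_s(-x)` if `x < 0`. -/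
def Omega (s x : ℝ) : ℂ :=
  if 0 < x then Ipos s x else (starRingEnd ℂ) (Ipos s (-x))

/-- `T(x) = -1/x mod 2`, for `x ≠ 0`, with representative in `[-1, 1)`. -/
def T (x : ℝ) : ℝ := -1 / x - 2 * (⌊(-1 / x + 1) / 2⌋ : ℝ)

/-- `|x T(x) ⋯ T^{j-1}(x)|`. -/
def absProd (x : ℝ) (j : ℕ) : ℝ := |∏ l ∈ Finset.range j, T^[l] x|

/-- `exp(i (π/4) ∑_{l=0}^{j-1} sign(T^l x))`. -/
def phase (x : ℝ) (j : ℕ) : ℂ :=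
  Complex.exp (Complex.I * (Real.pi / 4) * ((∑ l ∈ Finset.range j, Real.sign (T^[l] x) : ℝ) : ℂ))

/-- The denominator `Q_n` of the `n`-th convergent of the regular continued fraction of `x`
(`Q_0 = 1`, `Q_1 = A_1`, `Q_{n+1} = A_{n+1} Q_n + Q_{n-1}`). -/
def Q (x : ℝ) (n : ℕ) : ℝ := (GenContFract.of x).dens n

/-- The irrationality exponent `μ(x)`, as an extended real number (it may be `⊤`). -/
def irrationalityExponent (x : ℝ) : EReal :=
  sSup ((fun μ : ℝ => (μ : EReal)) ''
    {μ : ℝ | 1 ≤ μ ∧ {q : ℕ | 1 ≤ q ∧ ∃ p : ℤ, |x - (p : ℝ) / q| < 1 / (q : ℝ) ^ μ}.Infinite})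

/-- The series of complex numbers `∑_{j ≥ 0} a j` and the series `F_s(x)` both converge, as limits
of their partial sums, and have the same sum. -/
def FEqualsSeries (s x : ℝ) (a : ℕ → ℂ) : Prop :=
  ∃ F : ℂ, Tendsto (fun N : ℕ => partialF s x N) atTop (𝓝 F) ∧
    Tendsto (fun J : ℕ => ∑ j ∈ Finset.range J, a j) atTop (𝓝 F)

end ThetaSeries

end

open Filter Topology MeasureTheory Set

noncomputable section

namespace ThetaSeries

/-! The engine is an approximate functional equation. By residues, a partial sum of `F_s(x)` with `x
> 0` is the difference of the integrals of `e^{iπz²x} / (z^s (1 - e^{2iπz}))` along the lines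
through `1/2` and `N + 1/2` (`sum_kern_eq_mordell_sub`). On the far line, `K ≈ x(N + 1/2)` terms of
the geometric expansion of `1/(1 - e^{2iπz})` are split off. The `k`-th one is moved to its saddle
point `k/x`, where it becomes a Gaussian integral giving `x^{s-1/2} e^{-iπk²/x} / k^s` and a
correction that belongs to `I_s(x)`; what is left is `O(N^{-s})`. Hence, if `F_s(-1/x)` converges,
so does `F_s(x)`, and `F_s(x) = ρ x^{s-1/2} F_s(-1/x) + I_s(x)`; conjugation gives `x < 0`
(`tendsto_partialF`).

Iterating along the orbit of `T` produces the series of the theorem plus a remainder of modulus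
`θ^{s-1/2} |F_s(T^J x)|`, where `θ = |x T(x) ⋯ T^{J-1}(x)|`. It must be shown that every `F_s(T^J
x)` converges and that this remainder tends to `0`. Write `T^J x = y` with `x = (ay + b)/(cy + d)`
unimodular; then `θ = |a - cx|`. A good rational approximation of `y` transports to one of `x`, so
Weyl's inequality for `∑_{k≤N} e^{iπk²y}` can be stated through `ψ(M)`, the least denominator `q`
with `‖qx‖ ≤ 1/M`. The bound is `N/√(θ ψ(N/θ)) + √(N(1 + log N))` up to a constant
(`IsOrbit.norm_weylSum_le`).

Summation by parts then bounds `θ^{s-1/2} |F_s(y)|` by a constant times `∫_{1/(2θ)}^∞ M^{-s}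
ψ(M)^{-1/2} dM + θ^{s-1/2}` (`IsOrbit.exists_limit`). Since `θ → 0`, everything reduces to the
convergence of that integral (`FEqualsSeries_of_integrable`). As `ψ(M) ≥ Q_n/2` once `M ≥ 2Q_n`,
cutting the integral at the points `2Q_n` shows that (1) or (2) suffices. The claims on `μ(x)`
follow from `Q_{n+1} ≤ Q_n^{ν-1}` for large `n`, for some `ν` below the threshold, and the
exponential growth of `Q_n`. -/

/-! ### Lines in direction `ρ` and contour shifts between them. -/

theorem rho_re : rho.re = √2 / 2 := by
  have h : rho = Complex.exp (((Real.pi / 4 : ℝ) : ℂ) * Complex.I) := by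
    rw [rho]; push_cast; ring_nf
  rw [h, Complex.exp_ofReal_mul_I_re, Real.cos_pi_div_four]

theorem rho_im : rho.im = √2 / 2 := by
  have h : rho = Complex.exp (((Real.pi / 4 : ℝ) : ℂ) * Complex.I) := by
    rw [rho]; push_cast; ring_nf
  rw [h, Complex.exp_ofReal_mul_I_im, Real.sin_pi_div_four]

theorem rho_sq : rho ^ 2 = Complex.I := by
  rw [rho, ← Complex.exp_nat_mul]
  rw [show ((2 : ℕ) : ℂ) * (Complex.I * (Real.pi / 4)) = Real.pi / 2 * Complex.I by push_cast; ring]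
  exact Complex.exp_pi_div_two_mul_I

theorem norm_rho : ‖rho‖ = 1 := by
  rw [rho, Complex.norm_exp]; simp

theorem rho_ne_zero : rho ≠ 0 := Complex.exp_ne_zero _

theorem line_re (a u : ℝ) : ((a : ℂ) + rho * u).re = a + √2 / 2 * u := by
  simp [rho_re]

theorem line_im (a u : ℝ) : ((a : ℂ) + rho * u).im = √2 / 2 * u := by
  simp [rho_im]

theorem line_re_sub_im (a u : ℝ) : ((a : ℂ) + rho * u).re - ((a : ℂ) + rho * u).im = a := by
  rw [line_re, line_im]; ring

theorem half_sqrt_two_sq : (√2 / 2) ^ 2 = (1 / 2 : ℝ) := by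
  rw [div_pow, Real.sq_sqrt (by norm_num)]; norm_num

theorem half_sqrt_two_pos : (0 : ℝ) < √2 / 2 := by positivity

/-- A function that is continuous on the line `α + ρℝ` and has Gaussian decay is integrable there. -/
theorem integrable_line {g : ℂ → ℂ} {α C c T : ℝ} (hc : 0 < c)
    (hcont : ContinuousOn g {z | z.re - z.im = α})
    (hbd : ∀ z : ℂ, z.re - z.im = α → T ≤ |z.im| → ‖g z‖ ≤ C * Real.exp (-c * z.im ^ 2)) :
    Integrable (fun u : ℝ => g (α + rho * u)) := by
  have hint : Integrable (fun u : ℝ => Real.exp (-(c / 2) * u ^ 2)) :=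
    integrable_exp_neg_mul_sq (by positivity)
  have hcn : Continuous (fun u : ℝ => g (α + rho * u)) := by
    refine hcont.comp_continuous (by fun_prop) fun u => ?_
    exact line_re_sub_im α u
  have key : ∀ u : ℝ, T / (√2 / 2) ≤ |u| →
      ‖g (α + rho * u)‖ ≤ C * ‖Real.exp (-(c / 2) * u ^ 2)‖ := by
    intro u hu
    have h1 := hbd (α + rho * u) (line_re_sub_im α u) (by
      rw [line_im, abs_mul, abs_of_pos half_sqrt_two_pos]
      rw [div_le_iff₀ half_sqrt_two_pos] at hu
      linarith)
    rw [line_im, mul_pow, half_sqrt_two_sq] at h1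
    rw [Real.norm_eq_abs, Real.abs_exp]
    convert h1 using 3
    ring
  refine hcn.locallyIntegrable.integrable_of_isBigO_atBot_atTop
    (g := fun u : ℝ => Real.exp (-(c / 2) * u ^ 2))
    (g' := fun u : ℝ => Real.exp (-(c / 2) * u ^ 2)) ?_ (hint.integrableAtFilter _) ?_
    (hint.integrableAtFilter _)
  · refine Asymptotics.IsBigO.of_bound C ?_
    filter_upwards [eventually_le_atBot (-(T / (√2 / 2)))] with u hu
    refine key u (le_trans ?_ (neg_le_abs u))
    linarith
  · refine Asymptotics.IsBigO.of_bound C ?_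
    filter_upwards [eventually_ge_atTop (T / (√2 / 2))] with u hu
    exact key u (hu.trans (le_abs_self u))

/-- Cauchy's theorem for two parallel lines in direction `ρ`. -/
theorem integral_line_eq_of_strip {g : ℂ → ℂ} {a b C c T : ℝ} (hab : a ≤ b) (hc : 0 < c)
    {s : Set ℂ} (hs : s.Countable)
    (hcont : ContinuousOn g {z | z.re - z.im ∈ Icc a b})
    (hdiff : ∀ z : ℂ, z.re - z.im ∈ Ioo a b → z ∉ s → DifferentiableAt ℂ g z)
    (hbd : ∀ z : ℂ, z.re - z.im ∈ Icc a b → T ≤ |z.im| → ‖g z‖ ≤ C * Real.exp (-c * z.im ^ 2)) :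
    ∫ u : ℝ, g (a + rho * u) = ∫ u : ℝ, g (b + rho * u) := by
  set r : ℝ := √2 / 2 with hr
  have hr0 : 0 < r := half_sqrt_two_pos
  have hr2 : r ^ 2 = 1 / 2 := half_sqrt_two_sq
  -- With `z = ρζ` the line `z.re - z.im = α` becomes the horizontal line `ζ.im = -α r`, because
  -- `2r² = 1`. Cauchy's theorem on the rectangles `[-n, n] × [-br, -ar]` then applies.
  have hre : ∀ ζ : ℂ, (rho * ζ).re - (rho * ζ).im = -2 * r * ζ.im := by
    intro ζ; simp only [Complex.mul_re, Complex.mul_im, rho_re, rho_im, ← hr]; ring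
  have hkey : ∀ α y : ℝ, -2 * r * y - α = 2 * r * (-α * r - y) := fun α y => by
    linear_combination 2 * α * hr2
  have him : ∀ ζ : ℂ, (rho * ζ).im = r * (ζ.re + ζ.im) := by
    intro ζ; simp only [Complex.mul_im, rho_re, rho_im, ← hr]; ring
  have hline : ∀ α t : ℝ, rho * ((t : ℂ) + ((-α * r : ℝ) : ℂ) * Complex.I)
      = (α : ℂ) + rho * ((t - α * r : ℝ) : ℂ) := by
    intro α t
    apply Complex.ext
    · rw [line_re]; simp [rho_re, rho_im, ← hr]; linear_combination 2 * α * hr2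
    · rw [line_im]; simp [rho_re, rho_im, ← hr]; ring
  have hint : ∀ α ∈ Icc a b, Integrable (fun u : ℝ => g (α + rho * u)) := by
    intro α hα
    refine integrable_line (C := C) (T := T) hc (hcont.mono ?_) ?_
    · intro z hz; simp only [mem_ofPred_eq] at hz ⊢; rwa [hz]
    · intro z hz; exact hbd z (by rwa [hz])
  have hint2 : ∀ α ∈ Icc a b, Tendsto (fun n : ℕ => ∫ t in (-(n : ℝ))..n,
      g (rho * ((t : ℂ) + ((-α * r : ℝ) : ℂ) * Complex.I))) atTop
      (𝓝 (∫ u : ℝ, g (α + rho * u))) := by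
    intro α hα
    have h1 : Integrable (fun t : ℝ => g (rho * ((t : ℂ) + ((-α * r : ℝ) : ℂ) * Complex.I))) := by
      simp_rw [hline]
      exact (hint α hα).comp_sub_right (α * r)
    have h2 := intervalIntegral_tendsto_integral (a := fun n : ℕ => -(n : ℝ))
      (b := fun n : ℕ => (n : ℝ)) h1 (tendsto_neg_atTop_atBot.comp tendsto_natCast_atTop_atTop)
      tendsto_natCast_atTop_atTop
    convert h2 using 2
    simp_rw [hline]
    exact (integral_sub_right_eq_self (fun u : ℝ => g (α + rho * u)) (α * r)).symm
  have hvert : ∀ x : ℕ → ℝ, (∀ n, |x n| = n) →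
      Tendsto (fun n : ℕ => ∫ y in (-b * r)..(-a * r), g (rho * ((x n : ℂ) + (y : ℂ) * Complex.I)))
        atTop (𝓝 0) := by
    intro x hx
    -- `L` bounds the height of the rectangle, so on its vertical sides the imaginary part of `z`
    -- has modulus at least `r(n - L)` and the Gaussian bound makes these sides vanish in the limit.
    set L : ℝ := |a| + |b| with hL
    have hlim : Tendsto (fun n : ℕ => |C| * Real.exp (-c * (r * (n - L)) ^ 2) * |(-a * r) - (-b * r)|)
        atTop (𝓝 0) := by
      have h0 : Tendsto (fun n : ℕ => r * ((n : ℝ) - L)) atTop atTop :=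
        (tendsto_atTop_add_const_right _ (-L) tendsto_natCast_atTop_atTop).const_mul_atTop hr0
      have h1 : Tendsto (fun n : ℕ => c * (r * ((n : ℝ) - L)) ^ 2) atTop atTop :=
        ((tendsto_pow_atTop two_ne_zero).comp h0).const_mul_atTop hc
      have h2 := Real.tendsto_exp_neg_atTop_nhds_zero.comp h1
      have h3 := (h2.const_mul |C|).mul_const |(-a * r) - (-b * r)|
      simp only [mul_zero, zero_mul] at h3
      refine h3.congr fun n => ?_
      simp only [Function.comp]
      congr 3
      ring
    refine squeeze_zero_norm' ?_ hlim
    have hT : ∀ᶠ n : ℕ in atTop, (T / r + L : ℝ) ≤ n ∧ L ≤ n :=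
      (tendsto_natCast_atTop_atTop.eventually_ge_atTop _).and
        (tendsto_natCast_atTop_atTop.eventually_ge_atTop _)
    filter_upwards [hT] with n hn
    refine intervalIntegral.norm_integral_le_of_norm_le_const fun y hy => ?_
    rw [uIoc_of_le (by nlinarith)] at hy
    have hstrip : (rho * ((x n : ℂ) + (y : ℂ) * Complex.I)).re
        - (rho * ((x n : ℂ) + (y : ℂ) * Complex.I)).im ∈ Icc a b := by
      rw [hre]
      simp only [Complex.add_im, Complex.ofReal_im, Complex.mul_im, Complex.I_im, Complex.I_re,
        Complex.ofReal_re, mul_one, mul_zero, add_zero, zero_add]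
      exact ⟨by nlinarith [hkey a y, hy.2], by nlinarith [hkey b y, hy.1]⟩
    have hyL : |y| ≤ L := by
      have hr1 : r ≤ 1 := by nlinarith
      have h1 : -(|a| + |b|) ≤ -b * r := by
        have := le_abs_self b
        have := abs_nonneg b
        have := abs_nonneg a
        nlinarith
      have h2 : -a * r ≤ |a| + |b| := by
        have := neg_le_abs a
        have := abs_nonneg b
        have := abs_nonneg a
        nlinarith
      exact abs_le.2 ⟨by linarith [hy.1], by linarith [hy.2]⟩
    have himz : (rho * ((x n : ℂ) + (y : ℂ) * Complex.I)).im = r * (x n + y) := by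
      rw [him]; simp
    have hge : r * (n - L) ≤ |(rho * ((x n : ℂ) + (y : ℂ) * Complex.I)).im| := by
      rw [himz, abs_mul, abs_of_pos hr0]
      have : |x n| - |y| ≤ |x n + y| := by
        have := abs_sub_abs_le_abs_sub (x n) (-y)
        rwa [abs_neg, sub_neg_eq_add] at this
      rw [hx] at this
      exact mul_le_mul_of_nonneg_left (by linarith) hr0.le
    have hTle : T ≤ r * (n - L) := by
      have := hn.1
      rw [← le_sub_iff_add_le, div_le_iff₀ hr0] at this
      linarith
    refine (hbd _ hstrip (hTle.trans hge)).trans ?_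
    refine mul_le_mul (le_abs_self C) (Real.exp_le_exp.2 ?_) (Real.exp_pos _).le (abs_nonneg C)
    have : (r * (n - L)) ^ 2 ≤ (rho * ((x n : ℂ) + (y : ℂ) * Complex.I)).im ^ 2 := by
      rw [← sq_abs (rho * _ : ℂ).im]
      exact pow_le_pow_left₀ (mul_nonneg hr0.le (by linarith [hn.2])) hge 2
    nlinarith
  have hrect : ∀ n : ℕ, (∫ t in (-(n : ℝ))..n, g (rho * ((t : ℂ) + ((-b * r : ℝ) : ℂ) * Complex.I)))
      - (∫ t in (-(n : ℝ))..n, g (rho * ((t : ℂ) + ((-a * r : ℝ) : ℂ) * Complex.I)))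
      + Complex.I • (∫ y in (-b * r)..(-a * r), g (rho * (((n : ℝ) : ℂ) + (y : ℂ) * Complex.I)))
      - Complex.I • (∫ y in (-b * r)..(-a * r), g (rho * (((-(n : ℝ) : ℝ) : ℂ) + (y : ℂ) * Complex.I)))
      = 0 := by
    intro n
    have := Complex.integral_boundary_rect_eq_zero_of_differentiable_on_off_countable
      (fun ζ => g (rho * ζ)) ⟨-(n : ℝ), -b * r⟩ ⟨n, -a * r⟩ ((fun z => rho * z) ⁻¹' s)
      (hs.preimage (mul_right_injective₀ rho_ne_zero)) ?_ ?_
    · simpa using this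
    · refine hcont.comp (by fun_prop) ?_
      intro ζ hζ
      have h2 := hζ.2
      simp only [mem_preimage] at h2
      rw [uIcc_of_le (by nlinarith)] at h2
      simp only [mem_ofPred_eq]
      rw [hre]
      exact ⟨by nlinarith [hkey a ζ.im, h2.2], by nlinarith [hkey b ζ.im, h2.1]⟩
    · rintro ζ ⟨hζ, hζs⟩
      have h2 := hζ.2
      simp only [mem_preimage] at h2
      have hle : -b * r ≤ -a * r := by nlinarith
      rw [min_eq_left hle, max_eq_right hle] at h2
      refine DifferentiableAt.comp ζ (hdiff (rho * ζ) ?_ hζs) (by fun_prop)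
      rw [hre]
      exact ⟨by nlinarith [hkey a ζ.im, h2.2], by nlinarith [hkey b ζ.im, h2.1]⟩
  have hlim := ((hint2 b (right_mem_Icc.2 hab)).sub (hint2 a (left_mem_Icc.2 hab))).add
    (((hvert (fun n => n) (fun n => by simp)).const_smul Complex.I)) |>.sub
    ((hvert (fun n => -(n : ℝ)) (fun n => by simp)).const_smul Complex.I)
  have h0 := tendsto_nhds_unique (hlim.congr fun n => hrect n) tendsto_const_nhds
  simp only [smul_zero, add_zero, sub_zero] at h0
  exact (sub_eq_zero.1 h0).symm

/-! ### The kernel, the denominator, and their bounds on the lines. -/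

/-- The kernel `e^{iπz²x - 2iπκz} / z^s`. -/
def kern (s x κ : ℝ) (z : ℂ) : ℂ :=
  Complex.exp (Complex.I * Real.pi * z ^ 2 * x - 2 * Complex.I * Real.pi * κ * z) / z ^ (s : ℂ)

/-- The denominator `1 - e^{2iπz}`. -/
def den (z : ℂ) : ℂ := 1 - Complex.exp (2 * Complex.I * Real.pi * z)

theorem re_sub_im_le (z : ℂ) : z.re - z.im ≤ 2 * ‖z‖ := by
  have h1 := Complex.abs_re_le_norm z
  have h2 := Complex.abs_im_le_norm z
  linarith [le_abs_self z.re, neg_abs_le z.im]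

theorem mem_slitPlane_of_strip {z : ℂ} (h : 0 < z.re - z.im) : z ∈ Complex.slitPlane := by
  rw [Complex.mem_slitPlane_iff]
  by_cases hz : z.im = 0
  · left; linarith
  · right; exact hz

/-- With `v = z.re - z.im` and `y = z.im`, the exponent has real part `2π(κ - xv)y - 2πxy²`. Half of
the Gaussian decay is spent on completing the square in the linear term. The power is controlled by
`‖z‖ ≥ v/2`. -/
theorem norm_kern_le {s x κ a : ℝ} (hs : 0 ≤ s) (hx : 0 < x) (ha : 0 < a) {z : ℂ}
    (hz : a ≤ z.re - z.im) :
    ‖kern s x κ z‖ ≤ ((a / 2) ^ s)⁻¹ * Real.exp (Real.pi * (κ - x * (z.re - z.im)) ^ 2 / x) *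
      Real.exp (-(Real.pi * x) * z.im ^ 2) := by
  have h1 : (a / 2) ^ s ≤ ‖z‖ ^ s :=
    Real.rpow_le_rpow (by positivity) (by linarith [re_sub_im_le z]) hs
  have h0 : 0 < (a / 2) ^ s := by positivity
  rw [kern, norm_div, Complex.norm_cpow_real, Complex.norm_exp, div_eq_inv_mul,
    mul_assoc (((a / 2) ^ s)⁻¹), ← Real.exp_add]
  refine mul_le_mul (inv_anti₀ h0 h1) (Real.exp_le_exp.2 ?_) (Real.exp_pos _).le (by positivity)
  have e1 : (Complex.I * Real.pi * z ^ 2 * x - 2 * Complex.I * Real.pi * κ * z).re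
      = -(2 * Real.pi * x * z.re * z.im) + 2 * Real.pi * κ * z.im := by
    simp [pow_two]; ring
  rw [e1]
  have e2 : Real.pi * (κ - x * (z.re - z.im)) ^ 2 / x + -(Real.pi * x) * z.im ^ 2
      - (-(2 * Real.pi * x * z.re * z.im) + 2 * Real.pi * κ * z.im)
      = Real.pi / x * (κ - x * (z.re - z.im) - x * z.im) ^ 2 := by
    field_simp; ring
  have : 0 ≤ Real.pi / x * (κ - x * (z.re - z.im) - x * z.im) ^ 2 := by positivity
  linarith

theorem norm_kern_le_of_mem_Icc {s x κ a b : ℝ} (hs : 0 ≤ s) (hx : 0 < x) (ha : 0 < a) {z : ℂ}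
    (hz : z.re - z.im ∈ Icc a b) :
    ‖kern s x κ z‖ ≤ ((a / 2) ^ s)⁻¹ * Real.exp (Real.pi * (|κ| + x * b) ^ 2 / x) *
      Real.exp (-(Real.pi * x) * z.im ^ 2) := by
  refine (norm_kern_le hs hx ha hz.1).trans ?_
  have h1 : x * (z.re - z.im) ≤ x * b := mul_le_mul_of_nonneg_left hz.2 hx.le
  have h2 : 0 ≤ x * (z.re - z.im) := mul_nonneg hx.le (ha.le.trans hz.1)
  have h3 : (κ - x * (z.re - z.im)) ^ 2 ≤ (|κ| + x * b) ^ 2 :=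
    sq_le_sq' (by linarith [neg_abs_le κ]) (by linarith [le_abs_self κ])
  refine mul_le_mul_of_nonneg_right (mul_le_mul_of_nonneg_left (Real.exp_le_exp.2 ?_)
    (by positivity)) (Real.exp_pos _).le
  exact div_le_div_of_nonneg_right (mul_le_mul_of_nonneg_left h3 Real.pi_pos.le) hx.le

theorem differentiableAt_kern {s x κ : ℝ} {z : ℂ} (hz : 0 < z.re - z.im) :
    DifferentiableAt ℂ (kern s x κ) z := by
  have hslit := mem_slitPlane_of_strip hz
  have h0 : z ≠ 0 := Complex.slitPlane_ne_zero hslit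
  unfold kern
  refine DifferentiableAt.div (by fun_prop) ?_ ?_
  · exact (hasStrictDerivAt_id z).hasDerivAt.cpow_const hslit |>.differentiableAt
  · rw [Complex.cpow_def_of_ne_zero h0]; exact Complex.exp_ne_zero _

theorem differentiable_den : Differentiable ℂ den := by
  unfold den; fun_prop

theorem continuousOn_kern {s x κ : ℝ} {S : Set ℂ} (hS : ∀ z ∈ S, 0 < z.re - z.im) :
    ContinuousOn (kern s x κ) S := fun z hz =>
  (differentiableAt_kern (hS z hz)).continuousAt.continuousWithinAt

theorem integral_kern_line_eq {s x κ a b : ℝ} (hs : 0 ≤ s) (hx : 0 < x) (ha : 0 < a) (hb : 0 < b) :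
    ∫ u : ℝ, kern s x κ (a + rho * u) = ∫ u : ℝ, kern s x κ (b + rho * u) := by
  wlog hab : a ≤ b generalizing a b
  · exact (this hb ha (le_of_not_ge hab)).symm
  refine integral_line_eq_of_strip (c := Real.pi * x) (T := 0) hab (by positivity)
    countable_empty (continuousOn_kern fun z hz => lt_of_lt_of_le ha hz.1)
    (fun z hz _ => differentiableAt_kern (ha.trans hz.1))
    (fun z hz _ => norm_kern_le_of_mem_Icc hs hx ha hz)

theorem integrable_kern_line {s x κ a : ℝ} (hs : 0 ≤ s) (hx : 0 < x) (ha : 0 < a) :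
    Integrable (fun u : ℝ => kern s x κ (a + rho * u)) := by
  refine integrable_line (c := Real.pi * x) (T := 0) (by positivity)
    (continuousOn_kern fun z hz => ?_)
    (fun z hz _ => norm_kern_le_of_mem_Icc hs hx ha (b := a) (by rw [hz]; simp))
  rw [mem_ofPred_eq] at hz; rwa [hz]

theorem half_le_norm_den_of_le_im {z : ℂ} (hz : 1 / 4 ≤ |z.im|) : 1 / 2 ≤ ‖den z‖ := by
  have hw : ‖Complex.exp (2 * Complex.I * Real.pi * z)‖ = Real.exp (-(2 * Real.pi * z.im)) := by
    rw [Complex.norm_exp]; congr 1; simp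
  have h2 : 2 ≤ Real.exp 1 := by linarith [Real.add_one_le_exp 1]
  have hpi := Real.pi_gt_three
  rcases le_abs.1 hz with h | h
  · have h3 : Real.exp (-(2 * Real.pi * z.im)) ≤ 1 / 2 := by
      have : Real.exp (-(2 * Real.pi * z.im)) ≤ Real.exp (-1) := Real.exp_le_exp.2 (by nlinarith)
      rw [Real.exp_neg 1] at this
      refine this.trans ?_
      rw [one_div]; exact inv_anti₀ (by norm_num) h2
    have h4 := norm_sub_norm_le (1 : ℂ) (Complex.exp (2 * Complex.I * Real.pi * z))
    rw [norm_one, hw] at h4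
    rw [den]; linarith
  · have h3 : 2 ≤ Real.exp (-(2 * Real.pi * z.im)) :=
      h2.trans (Real.exp_le_exp.2 (by nlinarith))
    have h4 := norm_sub_norm_le (Complex.exp (2 * Complex.I * Real.pi * z)) (1 : ℂ)
    rw [norm_one, hw, norm_sub_rev] at h4
    rw [den]; linarith

/-- Far from the real axis `|e^{2iπz}|` is at most `1/2` or at least `2`. Near it, the half-integer
offset turns the phase of `e^{2iπz}` by `π`, so the real part of `den z` is `1` plus a nonnegative
multiple of a cosine of a small angle. -/
theorem half_le_norm_den_of_line {z : ℂ} {n : ℤ} (hz : z.re - z.im = n + 1 / 2) :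
    1 / 2 ≤ ‖den z‖ := by
  by_cases h : 1 / 4 ≤ |z.im|
  · exact half_le_norm_den_of_le_im h
  push Not at h
  have hv := abs_lt.1 h
  have hre : (den z).re = 1 + Real.exp (-(2 * Real.pi * z.im)) * Real.cos (2 * Real.pi * z.im) := by
    have e : (2 * Complex.I * Real.pi * z) = ((-(2 * Real.pi * z.im) : ℝ) : ℂ)
        + ((2 * Real.pi * z.re : ℝ) : ℂ) * Complex.I := by
      apply Complex.ext <;> simp
    rw [den, e, Complex.sub_re, Complex.exp_add, Complex.exp_ofReal_mul_I, ← Complex.ofReal_exp,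
      Complex.re_ofReal_mul]
    have e2 : 2 * Real.pi * z.re = 2 * Real.pi * z.im + Real.pi + n * (2 * Real.pi) := by
      linear_combination 2 * Real.pi * hz
    rw [e2]
    rw [Complex.add_re, Complex.ofReal_re,
      Complex.re_ofReal_mul, Complex.I_re, mul_zero, add_zero, Real.cos_add_int_mul_two_pi,
      Real.cos_add_pi]
    simp
  have hcos : 0 ≤ Real.cos (2 * Real.pi * z.im) := by
    have := Real.pi_pos
    refine Real.cos_nonneg_of_neg_pi_div_two_le_of_le ?_ ?_ <;> nlinarith
  have := Complex.re_le_norm (den z)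
  have h5 := mul_nonneg (Real.exp_pos (-(2 * Real.pi * z.im))).le hcos
  linarith

/-- The integral of `e^{iπz²x - 2iπκz} / (z^s (1 - e^{2iπz}))` along the line `a + ρℝ`. -/
def mordell (s x κ a : ℝ) : ℂ := ∫ u : ℝ, kern s x κ (a + rho * u) / den (a + rho * u) * rho

theorem lineIntegral_eq_mordell (s x : ℝ) : lineIntegral s x = mordell s x 0 (1 / 2) := by
  unfold lineIntegral mordell kern den
  congr 1
  ext u
  push_cast
  rw [div_div]
  congr 4
  ring

theorem den_ne_zero_of_line {z : ℂ} {n : ℤ} (hz : z.re - z.im = n + 1 / 2) : den z ≠ 0 := by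
  intro h
  have := half_le_norm_den_of_line hz
  rw [h, norm_zero] at this
  linarith

theorem integrable_div_den_line {g : ℂ → ℂ} {a C c : ℝ} {n : ℤ} (hn : a = n + 1 / 2) (hc : 0 < c)
    (hC : 0 ≤ C) (hcont : ContinuousOn g {z | z.re - z.im = a})
    (hbd : ∀ z : ℂ, z.re - z.im = a → ‖g z‖ ≤ C * Real.exp (-c * z.im ^ 2)) :
    Integrable (fun u : ℝ => g (a + rho * u) / den (a + rho * u)) := by
  refine integrable_line (g := fun z => g z / den z) (C := 2 * C) (T := 0) hc ?_ ?_
  · refine hcont.div differentiable_den.continuous.continuousOn fun z hz => ?_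
    rw [mem_ofPred_eq, hn] at hz
    exact den_ne_zero_of_line hz
  · intro z hz _
    have h1 := half_le_norm_den_of_line (hz.trans hn)
    rw [norm_div, div_le_iff₀ (by linarith)]
    have h2 : 0 ≤ C * Real.exp (-c * z.im ^ 2) := by positivity
    nlinarith [hbd z hz]

theorem integrable_kern_div_den_line {s x κ a : ℝ} {n : ℤ} (hn : a = n + 1 / 2) (hs : 0 ≤ s)
    (hx : 0 < x) (ha : 0 < a) :
    Integrable (fun u : ℝ => kern s x κ (a + rho * u) / den (a + rho * u)) := by
  refine integrable_div_den_line hn (c := Real.pi * x) (by positivity) (by positivity)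
    (continuousOn_kern fun z hz => ?_)
    (fun z hz => norm_kern_le_of_mem_Icc hs hx ha (b := a) (by rw [hz]; simp))
  rw [mem_ofPred_eq] at hz; rwa [hz]

/-! ### Crossing a pole: partial sums as differences of line integrals. -/

/-- The Gaussian comparison function with value `1` at `n`. -/
def bump (n z : ℂ) : ℂ :=
  Complex.exp (Complex.I * Real.pi * (z - n) ^ 2 + Complex.I * Real.pi * (z - n))

theorem norm_bump_le (n : ℝ) {z : ℂ} :
    ‖bump n z‖ ≤ Real.exp (Real.pi * (2 * (z.re - z.im - n) + 1) ^ 2 / 4) *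
      Real.exp (-Real.pi * z.im ^ 2) := by
  rw [bump, Complex.norm_exp, ← Real.exp_add]
  refine Real.exp_le_exp.2 ?_
  have e1 : (Complex.I * Real.pi * (z - n) ^ 2 + Complex.I * Real.pi * (z - n)).re
      = -(2 * Real.pi * (z.re - n) * z.im) - Real.pi * z.im := by
    simp [pow_two]; ring
  rw [e1]
  have := mul_nonneg Real.pi_pos.le (sq_nonneg (z.im + (2 * (z.re - z.im - n) + 1) / 2))
  nlinarith

theorem exp_int_mul_two_pi_I' (n : ℤ) : Complex.exp (2 * Complex.I * Real.pi * n) = 1 := by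
  rw [show 2 * Complex.I * Real.pi * (n : ℂ) = n * (2 * Real.pi * Complex.I) by ring]
  exact Complex.exp_int_mul_two_pi_mul_I n

theorem den_add_one (z : ℂ) : den (z + 1) = den z := by
  have := exp_int_mul_two_pi_I' 1
  push_cast at this
  rw [den, den, mul_add, Complex.exp_add, this, mul_one]

/-- The function `bump n` is designed so that `bump n (z + 1) = bump n z * e^{2iπz}`. As `den` has
period `1`, the two integrands differ by `bump n z` itself, which is `ρ⁻¹ e^{-πu²}` on the line
through `n - 1/2`. This is an explicit residue computation. -/
theorem integral_bump_sub (n : ℤ) :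
    (∫ u : ℝ, bump n (((n - 1 / 2 : ℝ) : ℂ) + rho * u) / den (((n - 1 / 2 : ℝ) : ℂ) + rho * u)) -
      (∫ u : ℝ, bump n (((n + 1 / 2 : ℝ) : ℂ) + rho * u) / den (((n + 1 / 2 : ℝ) : ℂ) + rho * u))
      = rho⁻¹ := by
  have hint : ∀ a : ℝ, (∃ m : ℤ, a = m + 1 / 2) →
      Integrable (fun u : ℝ => bump n (a + rho * u) / den (a + rho * u)) := by
    rintro a ⟨m, hm⟩
    refine integrable_div_den_line hm (c := Real.pi) Real.pi_pos
      (C := Real.exp (Real.pi * (2 * (a - n) + 1) ^ 2 / 4)) (Real.exp_pos _).le ?_ ?_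
    · unfold bump; fun_prop
    · intro z hz
      have := norm_bump_le n (z := z)
      rw [hz] at this
      exact_mod_cast this
  rw [← integral_sub (hint _ ⟨n - 1, by push_cast; ring⟩) (hint _ ⟨n, rfl⟩)]
  have key : ∀ u : ℝ, bump n (((n - 1 / 2 : ℝ) : ℂ) + rho * u) / den (((n - 1 / 2 : ℝ) : ℂ) + rho * u)
      - bump n (((n + 1 / 2 : ℝ) : ℂ) + rho * u) / den (((n + 1 / 2 : ℝ) : ℂ) + rho * u)
      = rho⁻¹ * ((Real.exp (-Real.pi * u ^ 2) : ℝ) : ℂ) := by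
    intro u
    set z : ℂ := ((n - 1 / 2 : ℝ) : ℂ) + rho * u with hz
    have hz1 : ((n + 1 / 2 : ℝ) : ℂ) + rho * u = z + 1 := by rw [hz]; push_cast; ring
    have hd : den z ≠ 0 := den_ne_zero_of_line (n := n - 1) (by
      rw [hz, line_re_sub_im]; push_cast; ring)
    rw [hz1, den_add_one, ← sub_div]
    have hb : bump n (z + 1) = bump n z * Complex.exp (2 * Complex.I * Real.pi * z) := by
      rw [bump, bump, ← Complex.exp_add]
      rw [show Complex.I * Real.pi * (z + 1 - n) ^ 2 + Complex.I * Real.pi * (z + 1 - n)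
        = (Complex.I * Real.pi * (z - n) ^ 2 + Complex.I * Real.pi * (z - n)
          + 2 * Complex.I * Real.pi * z) + 2 * Complex.I * Real.pi * ((1 - n : ℤ) : ℂ) by
          push_cast; ring, Complex.exp_add, exp_int_mul_two_pi_I', mul_one]
    rw [hb, ← mul_one_sub, ← den, mul_div_cancel_right₀ _ hd, bump, rho, ← Complex.exp_neg,
      Complex.ofReal_exp, ← Complex.exp_add]
    congr 1
    have h2 := rho_sq
    rw [hz]; push_cast
    linear_combination (Complex.I * Real.pi * u ^ 2) * h2 + Real.pi * u ^ 2 * Complex.I_sq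
  simp_rw [key]
  rw [integral_const_mul, integral_complex_ofReal, integral_gaussian, div_self Real.pi_pos.ne',
    Real.sqrt_one]
  simp

/-- The multiple of `bump n` with the same value at `n` is subtracted from the kernel. The
difference divided by `den` has no pole in the strip, so its two line integrals agree, and the
residue is that of the explicit comparison function. -/
theorem integral_kern_div_den_sub {s x : ℝ} (hs : 0 ≤ s) (hx : 0 < x) {n : ℤ} (hn : 1 ≤ n) :
    mordell s x 0 (n - 1 / 2) - mordell s x 0 (n + 1 / 2) = kern s x 0 n := by
  have hn1 : (1 : ℝ) ≤ n := by exact_mod_cast hn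
  set a : ℝ := n - 1 / 2 with ha
  set b : ℝ := n + 1 / 2 with hb
  have ha0 : 0 < a := by rw [ha]; linarith
  set num : ℂ → ℂ := fun z => kern s x 0 z - kern s x 0 n * bump n z with hnum
  have hnumn : num n = 0 := by simp [hnum, bump]
  have hdenn : den n = 0 := by rw [den, exp_int_mul_two_pi_I', sub_self]
  have hderiv : deriv den n ≠ 0 := by
    have h1 : HasDerivAt den (-(Complex.exp (2 * Complex.I * Real.pi * n) *
        (2 * Complex.I * Real.pi * 1))) (n : ℂ) :=
      ((((hasDerivAt_id (n : ℂ)).const_mul (2 * Complex.I * Real.pi))).cexp).const_sub 1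
    rw [h1.deriv, exp_int_mul_two_pi_I']
    simp [Real.pi_ne_zero]
  have hdiffnum : ∀ z : ℂ, 0 < z.re - z.im → DifferentiableAt ℂ num z := by
    intro z hz
    refine (differentiableAt_kern hz).sub (DifferentiableAt.const_mul ?_ _)
    unfold bump; fun_prop
  have hden0 : ∀ z : ℂ, z.re - z.im ∈ Icc a b → z ≠ n → den z ≠ 0 := by
    intro z hz hzn h
    rw [den, sub_eq_zero, eq_comm, Complex.exp_eq_one_iff] at h
    obtain ⟨m, hm⟩ := h
    have hzm : z = m := by
      have h2 : (2 * Real.pi * Complex.I) ≠ 0 := by simp [Real.pi_ne_zero]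
      apply mul_left_cancel₀ h2
      linear_combination hm
    rw [hzm] at hz
    simp only [Complex.intCast_re, Complex.intCast_im, sub_zero] at hz
    apply hzn
    rw [hzm]
    congr 1
    have h1 : (n : ℝ) - 1 < m := by linarith [hz.1]
    have h2 : (m : ℝ) < n + 1 := by linarith [hz.2]
    have h1' : n - 1 < m := by exact_mod_cast h1
    have h2' : m < n + 1 := by exact_mod_cast h2
    omega
  -- The quotient of the two `dslope`s is the continuous extension of `num / den` across the common
  -- zero `n`.
  have hquot : ∀ z : ℂ, z ≠ n → dslope num n z / dslope den n z = num z / den z := by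
    intro z hz
    rw [dslope_of_ne _ hz, dslope_of_ne _ hz, slope_def_field, slope_def_field, hnumn, hdenn,
      sub_zero, sub_zero, div_div_div_cancel_right₀ (sub_ne_zero.2 hz)]
  have hds0 : ∀ z : ℂ, z.re - z.im ∈ Icc a b → dslope den n z ≠ 0 := by
    intro z hz
    by_cases hzn : z = n
    · rw [hzn, dslope_same]; exact hderiv
    · rw [dslope_of_ne _ hzn, slope_def_field, hdenn, sub_zero]
      exact div_ne_zero (hden0 z hz hzn) (sub_ne_zero.2 hzn)
  have hcont : ContinuousOn (fun z => dslope num n z / dslope den n z)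
      {z | z.re - z.im ∈ Icc a b} := by
    intro z hz
    refine ContinuousAt.continuousWithinAt ?_
    have hd := hdiffnum z (lt_of_lt_of_le ha0 hz.1)
    refine ContinuousAt.div ?_ ?_ (hds0 z hz)
    · by_cases hzn : z = n
      · rw [hzn] at hd ⊢; exact continuousAt_dslope_same.2 hd
      · exact (continuousAt_dslope_of_ne hzn).2 hd.continuousAt
    · by_cases hzn : z = n
      · rw [hzn]; exact continuousAt_dslope_same.2 (differentiable_den _)
      · exact (continuousAt_dslope_of_ne hzn).2 (differentiable_den _).continuousAt
  have hdiff : ∀ z : ℂ, z.re - z.im ∈ Ioo a b → z ∉ ({(n : ℂ)} : Set ℂ) →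
      DifferentiableAt ℂ (fun z => dslope num n z / dslope den n z) z := by
    intro z hz hzn
    exact ((differentiableAt_dslope_of_ne hzn).2 (hdiffnum z (ha0.trans hz.1))).div
      ((differentiableAt_dslope_of_ne hzn).2 (differentiable_den _))
      (hds0 z (Ioo_subset_Icc_self hz))
  set c : ℝ := min (Real.pi * x) Real.pi with hc
  have hc0 : 0 < c := lt_min (by positivity) Real.pi_pos
  have hnumbd : ∃ C : ℝ, 0 ≤ C ∧ ∀ z : ℂ, z.re - z.im ∈ Icc a b →
      ‖num z‖ ≤ C * Real.exp (-c * z.im ^ 2) := by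
    refine ⟨((a / 2) ^ s)⁻¹ * Real.exp (Real.pi * (|0| + x * b) ^ 2 / x) +
      ‖kern s x 0 n‖ * Real.exp (Real.pi * 2 ^ 2 / 4), by positivity, fun z hz => ?_⟩
    have h1 := norm_kern_le_of_mem_Icc (κ := 0) hs hx ha0 hz
    have h2 := norm_bump_le n (z := z)
    have e1 : Real.exp (-(Real.pi * x) * z.im ^ 2) ≤ Real.exp (-c * z.im ^ 2) := by
      refine Real.exp_le_exp.2 ?_
      nlinarith [min_le_left (Real.pi * x) Real.pi, sq_nonneg z.im]
    have e2 : Real.exp (-Real.pi * z.im ^ 2) ≤ Real.exp (-c * z.im ^ 2) := by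
      refine Real.exp_le_exp.2 ?_
      nlinarith [min_le_right (Real.pi * x) Real.pi, sq_nonneg z.im]
    have e3 : Real.exp (Real.pi * (2 * (z.re - z.im - n) + 1) ^ 2 / 4)
        ≤ Real.exp (Real.pi * 2 ^ 2 / 4) := by
      refine Real.exp_le_exp.2 ?_
      have h3 : -2 ≤ 2 * (z.re - z.im - n) + 1 := by linarith [hz.1]
      have h4 : 2 * (z.re - z.im - n) + 1 ≤ 2 := by linarith [hz.2]
      have h5 := sq_le_sq' h3 h4
      have := Real.pi_pos
      gcongr
    calc ‖num z‖ ≤ ‖kern s x 0 z‖ + ‖kern s x 0 n‖ * ‖bump n z‖ := by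
          rw [← norm_mul]; exact norm_sub_le _ _
      _ ≤ ((a / 2) ^ s)⁻¹ * Real.exp (Real.pi * (|0| + x * b) ^ 2 / x) *
            Real.exp (-c * z.im ^ 2) + ‖kern s x 0 n‖ *
            (Real.exp (Real.pi * 2 ^ 2 / 4) * Real.exp (-c * z.im ^ 2)) := by
          refine add_le_add (h1.trans (by gcongr)) ?_
          refine mul_le_mul_of_nonneg_left ?_ (norm_nonneg _)
          push_cast at h2
          exact h2.trans (mul_le_mul e3 e2 (Real.exp_pos _).le (Real.exp_pos _).le)
      _ = _ := by ring
  obtain ⟨C, hC0, hC⟩ := hnumbd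
  -- The threshold `T = 1` keeps `z` away from the real point `n`, where the quotient is not
  -- literally `num / den`, and also makes `‖den z‖ ≥ 1/2`.
  have hshift := integral_line_eq_of_strip (g := fun z => dslope num n z / dslope den n z)
    (a := a) (b := b) (C := 2 * C) (T := 1) (by rw [ha, hb]; linarith) hc0
    (countable_singleton (n : ℂ)) hcont hdiff (by
      intro z hz hT
      have hzn : z ≠ n := by
        rintro rfl
        simp at hT
        linarith
      rw [hquot z hzn]
      have h1 := half_le_norm_den_of_le_im (z := z) (by linarith)
      rw [norm_div, div_le_iff₀ (by linarith)]
      have h2 : 0 ≤ C * Real.exp (-c * z.im ^ 2) := by positivity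
      nlinarith [hC z hz])
  have hne : ∀ α : ℝ, α ≠ n → ∀ u : ℝ, (α : ℂ) + rho * u ≠ n := by
    intro α hα u h
    have := line_re_sub_im α u
    rw [h] at this
    simp at this
    exact hα this.symm
  have hval : ∀ α : ℝ, α ≠ n → 0 < α → (∃ m : ℤ, α = m + 1 / 2) →
      ∫ u : ℝ, dslope num n (α + rho * u) / dslope den n (α + rho * u) =
      (∫ u : ℝ, kern s x 0 (α + rho * u) / den (α + rho * u)) -
        kern s x 0 n * ∫ u : ℝ, bump n (α + rho * u) / den (α + rho * u) := by
    rintro α hα hα0 ⟨m, hm⟩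
    rw [← integral_const_mul, ← integral_sub]
    · congr 1
      ext u
      rw [hquot _ (hne α hα u), hnum]
      ring
    · exact integrable_kern_div_den_line hm hs hx hα0
    · refine Integrable.const_mul ?_ _
      refine integrable_div_den_line hm (c := Real.pi) Real.pi_pos
        (C := Real.exp (Real.pi * (2 * (α - n) + 1) ^ 2 / 4)) (Real.exp_pos _).le ?_ ?_
      · unfold bump; fun_prop
      · intro z hz
        have := norm_bump_le n (z := z)
        rw [hz] at this
        exact_mod_cast this
  rw [hval a (by rw [ha]; linarith) ha0 ⟨n - 1, by rw [ha]; push_cast; ring⟩,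
    hval b (by rw [hb]; linarith) (by linarith) ⟨n, rfl⟩] at hshift
  have hbump := integral_bump_sub n
  rw [← ha, ← hb] at hbump
  unfold mordell
  rw [integral_mul_const, integral_mul_const]
  linear_combination rho * hshift + rho * kern s x 0 n * hbump + kern s x 0 n * (mul_inv_cancel₀ rho_ne_zero)

theorem sum_Icc_one_eq_sum_range {M : Type*} [AddCommMonoid M] (f : ℕ → M) (N : ℕ) :
    ∑ k ∈ Finset.Icc 1 N, f k = ∑ k ∈ Finset.range N, f (k + 1) := by
  induction N with
  | zero => simp
  | succ N ih => rw [Finset.sum_Icc_succ_top (by omega), ih, Finset.sum_range_succ]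

theorem sum_kern_eq_mordell_sub {s x : ℝ} (hs : 0 ≤ s) (hx : 0 < x) (N : ℕ) :
    partialF s x N = mordell s x 0 (1 / 2) - mordell s x 0 (N + 1 / 2) := by
  induction N with
  | zero => simp [partialF]
  | succ N ih =>
    rw [partialF, Finset.sum_Icc_succ_top (by omega), ← partialF, ih]
    have h := integral_kern_div_den_sub hs hx (n := N + 1) (by omega)
    have e : kern s x 0 ((N + 1 : ℕ) : ℂ) =
        Complex.exp (Complex.I * Real.pi * ((N + 1 : ℕ) : ℂ) ^ 2 * x) /
          ((((N + 1 : ℕ) : ℝ) ^ s : ℝ) : ℂ) := by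
      rw [kern, Complex.ofReal_cpow (by positivity)]
      simp
    rw [← e]
    push_cast at h ⊢
    rw [← h]
    rw [show (N : ℝ) + 1 - 1 / 2 = N + 1 / 2 by ring]
    ring

/-! ### Expanding the far line integral and passing to the saddle points. -/

/-- With `w = e^{2iπz}`, lowering `κ` by one multiplies the kernel by `w`, and `w/(1 - w) = 1/(1 -
w) - 1`. -/
theorem mordell_step {s x a : ℝ} {m : ℤ} (ha : a = m + 1 / 2) (hs : 0 ≤ s) (hx : 0 < x)
    (ha0 : 0 < a) (k : ℕ) :
    mordell s x k a = mordell s x (k + 1 : ℕ) a -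
      rho * ∫ u : ℝ, kern s x (k + 1 : ℕ) (a + rho * u) := by
  unfold mordell
  rw [integral_mul_const, integral_mul_const, mul_comm rho, ← sub_mul,
    ← integral_sub (integrable_kern_div_den_line ha hs hx ha0) (integrable_kern_line hs hx ha0)]
  congr 2
  ext u
  have hd : den (a + rho * u) ≠ 0 := den_ne_zero_of_line (n := m) (by rw [line_re_sub_im, ha])
  set z : ℂ := a + rho * u
  have hk : kern s x k z = kern s x (k + 1 : ℕ) z * Complex.exp (2 * Complex.I * Real.pi * z) := by
    rw [kern, kern, div_mul_eq_mul_div, ← Complex.exp_add]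
    congr 2
    push_cast; ring
  rw [hk, div_sub' hd, div_left_inj' hd, den]
  ring

theorem mordell_eq_sub_sum {s x a : ℝ} {m : ℤ} (ha : a = m + 1 / 2) (hs : 0 ≤ s) (hx : 0 < x)
    (ha0 : 0 < a) (K : ℕ) :
    mordell s x 0 a = mordell s x K a -
      ∑ k ∈ Finset.range K, rho * ∫ u : ℝ, kern s x (k + 1 : ℕ) (a + rho * u) := by
  induction K with
  | zero => simp
  | succ K ih => rw [ih, mordell_step ha hs hx ha0, Finset.sum_range_succ]; ring

/-- When `κ` is within `1` of `xa`, the saddle point `κ/x` lies within `1/x` of the line, so the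
exponential loss in `norm_kern_le` is bounded uniformly in `a`. Only the decay `a^{-s}` remains. -/
theorem norm_mordell_le {s x κ a : ℝ} {m : ℤ} (ha : a = m + 1 / 2) (hs : 0 ≤ s) (hx : 0 < x)
    (ha0 : 0 < a) (hκ : |κ - x * a| ≤ 1) :
    ‖mordell s x κ a‖ ≤ ((a / 2) ^ s)⁻¹ *
      (2 * Real.exp (Real.pi / x) * ∫ u : ℝ, Real.exp (-(Real.pi * x / 2) * u ^ 2)) := by
  rw [mordell, ← integral_const_mul, ← integral_const_mul]
  refine norm_integral_le_of_norm_le ?_ (ae_of_all _ fun u => ?_)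
  · refine Integrable.const_mul (Integrable.const_mul ?_ _) _
    exact integrable_exp_neg_mul_sq (by positivity)
  have h1 := half_le_norm_den_of_line (z := a + rho * u) (n := m) (by rw [line_re_sub_im, ha])
  have h2 := norm_kern_le (κ := κ) hs hx ha0 (z := a + rho * u) (by rw [line_re_sub_im])
  rw [line_re_sub_im, line_im, mul_pow, half_sqrt_two_sq] at h2
  have h3 : Real.exp (Real.pi * (κ - x * a) ^ 2 / x) ≤ Real.exp (Real.pi / x) := by
    refine Real.exp_le_exp.2 (div_le_div_of_nonneg_right ?_ hx.le)
    have : (κ - x * a) ^ 2 ≤ 1 := (sq_le_one_iff_abs_le_one _).2 hκ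
    nlinarith [Real.pi_pos]
  have h4 : -(Real.pi * x) * (1 / 2 * u ^ 2) = -(Real.pi * x / 2) * u ^ 2 := by ring
  rw [h4] at h2
  have h5 : 0 ≤ ((a / 2) ^ s)⁻¹ := by positivity
  have h6 := Real.exp_pos (-(Real.pi * x / 2) * u ^ 2)
  rw [norm_mul, norm_rho, mul_one, norm_div, div_le_iff₀ (by linarith)]
  calc ‖kern s x κ (a + rho * u)‖ ≤ ((a / 2) ^ s)⁻¹ * Real.exp (Real.pi / x) *
        Real.exp (-(Real.pi * x / 2) * u ^ 2) := h2.trans (by gcongr)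
    _ ≤ ((a / 2) ^ s)⁻¹ * (2 * Real.exp (Real.pi / x) *
        Real.exp (-(Real.pi * x / 2) * u ^ 2)) * (1 / 2) := by
        apply le_of_eq; ring
    _ ≤ _ := by gcongr

theorem ofReal_mul_cpow {x : ℝ} (hx : 0 < x) {z : ℂ} (hz : z ≠ 0) (s : ℝ) :
    ((x : ℂ) * z) ^ (s : ℂ) = ((x ^ s : ℝ) : ℂ) * z ^ (s : ℂ) := by
  have hx' : (x : ℂ) ≠ 0 := by exact_mod_cast hx.ne'
  rw [Complex.cpow_def_of_ne_zero (mul_ne_zero hx' hz), Complex.log_ofReal_mul hx hz,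
    Complex.cpow_def_of_ne_zero hz, Complex.ofReal_cpow hx.le, Complex.cpow_def_of_ne_zero hx',
    Complex.ofReal_log hx.le, ← Complex.exp_add]
  congr 1; ring

theorem line_ne_zero {a : ℝ} (ha : 0 < a) (u : ℝ) : (a : ℂ) + rho * u ≠ 0 := by
  intro h
  have := line_re_sub_im a u
  rw [h] at this
  simp at this
  exact ha.ne this

/-- With `k = m + 1`, the exponent is `iπx(z - k/x)² - iπk²/x`. On the line through `k/x` the square
is `ρ²u² = iu²`, so the first part is the real Gaussian `-πxu²`. -/
theorem integral_kern_saddle {s x : ℝ} (hx : 0 < x) (m : ℕ) :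
    ∫ u : ℝ, kern s x (m + 1 : ℕ) ((((m : ℝ) + 1) / x : ℝ) + rho * u) =
      ((x ^ s : ℝ) : ℂ) * Complex.exp (-(Complex.I * Real.pi * ((m : ℂ) + 1) ^ 2 / x)) *
        ∫ u : ℝ, ((Real.exp (-(Real.pi * x * u ^ 2)) : ℝ) : ℂ) *
          (1 / (rho * x * u + ((m : ℂ) + 1)) ^ (s : ℂ)) := by
  rw [← integral_const_mul]
  congr 1
  ext u
  have hx' : (x : ℂ) ≠ 0 := by exact_mod_cast hx.ne'
  have hz := line_ne_zero (a := ((m : ℝ) + 1) / x) (by positivity) u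
  have e1 : rho * x * u + ((m : ℂ) + 1) = (x : ℂ) * ((((m : ℝ) + 1) / x : ℝ) + rho * u) := by
    push_cast; field_simp; ring
  have hxs : ((x ^ s : ℝ) : ℂ) ≠ 0 := by
    exact_mod_cast (Real.rpow_pos_of_pos hx s).ne'
  rw [e1, ofReal_mul_cpow hx hz, kern, Complex.ofReal_exp]
  have e2 : Complex.I * Real.pi * ((((m : ℝ) + 1) / x : ℝ) + rho * u) ^ 2 * x
      - 2 * Complex.I * Real.pi * ((m + 1 : ℕ) : ℝ) * ((((m : ℝ) + 1) / x : ℝ) + rho * u)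
      = -(Complex.I * Real.pi * ((m : ℂ) + 1) ^ 2 / x) + ((-(Real.pi * x * u ^ 2) : ℝ) : ℂ) := by
    have h2 := rho_sq
    push_cast
    field_simp
    linear_combination (Complex.I * x ^ 2 * u ^ 2) * h2 + x ^ 2 * u ^ 2 * Complex.I_sq
  rw [e2, Complex.exp_add]
  generalize ((((((m : ℝ) + 1) / x : ℝ) : ℂ) + rho * u) ^ (s : ℂ)) = w
  rw [one_div, mul_inv]
  field_simp

theorem mem_strip_scaled (x u : ℝ) (m : ℕ) :
    (rho * x * u + ((m : ℂ) + 1)).re - (rho * x * u + ((m : ℂ) + 1)).im = (m : ℝ) + 1 := by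
  have := line_re_sub_im ((m : ℝ) + 1) (x * u)
  rw [← this]
  push_cast
  congr 2 <;> ring

/-- Bound for the terms of the inner series. -/
theorem norm_inner_term_le {s x : ℝ} (hs : 0 ≤ s) (hx : 0 < x) (u : ℝ) (m : ℕ) :
    ‖1 / (rho * x * u + ((m : ℂ) + 1)) ^ (s : ℂ) - 1 / ((m : ℂ) + 1) ^ (s : ℂ)‖ ≤
      s * x * 2 ^ (s + 1) * (1 / ((m : ℝ) + 1) ^ (s + 1)) * |u| := by
  have hm : (0 : ℝ) < (m : ℝ) + 1 := by positivity
  set φ : ℝ → ℂ := fun t => (rho * x * (u * t : ℝ) + ((m : ℂ) + 1)) ^ (-(s : ℂ)) with hφ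
  -- The segment from `m + 1` to `ρxu + m + 1` runs in direction `ρ`, along which `re - im` stays
  -- equal to `m + 1`. It therefore avoids both the origin and the branch cut.
  have hlow : ∀ t : ℝ, ((m : ℝ) + 1) / 2 ≤ ‖rho * x * (u * t : ℝ) + ((m : ℂ) + 1)‖ := by
    intro t
    have h1 := re_sub_im_le (rho * x * (u * t : ℝ) + ((m : ℂ) + 1))
    rw [mem_strip_scaled] at h1
    linarith
  have hder : ∀ t ∈ Icc (0 : ℝ) 1, HasDerivWithinAt φ
      (-(s : ℂ) * (rho * x * (u * t : ℝ) + ((m : ℂ) + 1)) ^ (-(s : ℂ) - 1) * (rho * x * u))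
      (Icc 0 1) t := by
    intro t _
    have h1 : HasDerivAt (fun t : ℂ => rho * x * (u * t) + ((m : ℂ) + 1)) (rho * x * u) (t : ℂ) := by
      have := (((hasDerivAt_id (t : ℂ)).const_mul (u : ℂ)).const_mul (rho * x)).add_const ((m : ℂ) + 1)
      simpa using this
    have h2 := h1.cpow_const (c := -(s : ℂ)) (mem_slitPlane_of_strip (by
      have := mem_strip_scaled x (u * t) m
      push_cast at this
      rw [this]; exact hm))
    have h3 := h2.comp_ofReal
    simp only [hφ]
    push_cast
    exact h3.hasDerivWithinAt
  have hbd : ∀ t ∈ Ico (0 : ℝ) 1,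
      ‖-(s : ℂ) * (rho * x * (u * t : ℝ) + ((m : ℂ) + 1)) ^ (-(s : ℂ) - 1) * (rho * x * u)‖ ≤
      s * x * 2 ^ (s + 1) * (1 / ((m : ℝ) + 1) ^ (s + 1)) * |u| := by
    intro t _
    have e : (-(s : ℂ) - 1) = ((-(s + 1) : ℝ) : ℂ) := by push_cast; ring
    rw [e, norm_mul, norm_mul, norm_mul, norm_mul, norm_rho, Complex.norm_cpow_real, norm_neg,
      Complex.norm_real, Complex.norm_real, Complex.norm_real, Real.norm_of_nonneg hs,
      Real.norm_of_nonneg hx.le, Real.norm_eq_abs, one_mul]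
    have h1 : ‖rho * x * (u * t : ℝ) + ((m : ℂ) + 1)‖ ^ (-(s + 1)) ≤
        2 ^ (s + 1) * (1 / ((m : ℝ) + 1) ^ (s + 1)) := by
      rw [Real.rpow_neg (norm_nonneg _), mul_one_div, ← inv_div, ← Real.div_rpow hm.le (by norm_num)]
      refine inv_anti₀ (by positivity) ?_
      exact Real.rpow_le_rpow (by positivity) (hlow t) (by linarith)
    calc s * ‖rho * x * (u * t : ℝ) + ((m : ℂ) + 1)‖ ^ (-(s + 1)) * (x * |u|)
        ≤ s * (2 ^ (s + 1) * (1 / ((m : ℝ) + 1) ^ (s + 1))) * (x * |u|) := by gcongr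
      _ = _ := by ring
  have := norm_image_sub_le_of_norm_deriv_le_segment_01' hder hbd
  simp only [hφ, mul_one, mul_zero, Complex.ofReal_zero, zero_add] at this
  rwa [Complex.cpow_neg, Complex.cpow_neg, ← one_div, ← one_div] at this

theorem continuous_inner_term {s x : ℝ} (m : ℕ) :
    Continuous (fun u : ℝ => 1 / (rho * x * u + ((m : ℂ) + 1)) ^ (s : ℂ)) := by
  have h : ∀ u : ℝ, rho * x * u + ((m : ℂ) + 1) ∈ Complex.slitPlane := fun u =>
    mem_slitPlane_of_strip (by rw [mem_strip_scaled]; positivity)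
  refine continuous_const.div ?_ fun u => ?_
  · exact Continuous.cpow (by fun_prop) continuous_const h
  · rw [Complex.cpow_def_of_ne_zero (Complex.slitPlane_ne_zero (h u))]
    exact Complex.exp_ne_zero _

theorem integrable_abs_mul_gauss {x : ℝ} (hx : 0 < x) :
    Integrable (fun u : ℝ => Real.exp (-(Real.pi * x * u ^ 2)) * |u|) := by
  have := (integrable_mul_exp_neg_mul_sq (b := Real.pi * x) (by positivity)).abs
  refine this.congr (ae_of_all _ fun u => ?_)
  simp only [abs_mul, Real.abs_exp]
  rw [mul_comm]; congr 2; ring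

theorem integrable_inner_term {s x : ℝ} (hs : 0 ≤ s) (hx : 0 < x) (m : ℕ) :
    Integrable (fun u : ℝ => ((Real.exp (-(Real.pi * x * u ^ 2)) : ℝ) : ℂ) *
      (1 / (rho * x * u + ((m : ℂ) + 1)) ^ (s : ℂ) - 1 / ((m : ℂ) + 1) ^ (s : ℂ))) := by
  refine ((integrable_abs_mul_gauss hx).const_mul
    (s * x * 2 ^ (s + 1) * (1 / ((m : ℝ) + 1) ^ (s + 1)))).mono' ?_ (ae_of_all _ fun u => ?_)
  · refine (Continuous.mul (by fun_prop) ?_).aestronglyMeasurable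
    exact (continuous_inner_term m).sub continuous_const
  · rw [norm_mul, Complex.norm_real, Real.norm_of_nonneg (Real.exp_pos _).le]
    have := mul_le_mul_of_nonneg_left (norm_inner_term_le hs hx u m)
      (Real.exp_pos (-(Real.pi * x * u ^ 2))).le
    linarith

theorem integral_gauss_complex {x : ℝ} :
    ∫ u : ℝ, ((Real.exp (-(Real.pi * x * u ^ 2)) : ℝ) : ℂ) = ((√(1 / x) : ℝ) : ℂ) := by
  rw [integral_complex_ofReal]
  have := integral_gaussian (Real.pi * x)
  rw [show Real.pi / (Real.pi * x) = 1 / x by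
    rw [div_mul_eq_div_div, div_self Real.pi_ne_zero]] at this
  rw [← this]
  congr 3
  ext u
  congr 1; ring

theorem integrable_gauss_complex {x : ℝ} (hx : 0 < x) :
    Integrable (fun u : ℝ => ((Real.exp (-(Real.pi * x * u ^ 2)) : ℝ) : ℂ)) := by
  have := (integrable_exp_neg_mul_sq (b := Real.pi * x) (by positivity)).ofReal (𝕜 := ℂ)
  refine this.congr (ae_of_all _ fun u => ?_)
  simp only [neg_mul]
  rfl

theorem integral_gauss_mul_inv {s x : ℝ} (hs : 0 ≤ s) (hx : 0 < x) (m : ℕ) :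
    ∫ u : ℝ, ((Real.exp (-(Real.pi * x * u ^ 2)) : ℝ) : ℂ) *
      (1 / (rho * x * u + ((m : ℂ) + 1)) ^ (s : ℂ)) =
    ((√(1 / x) : ℝ) : ℂ) * (1 / ((m : ℂ) + 1) ^ (s : ℂ)) +
      ∫ u : ℝ, ((Real.exp (-(Real.pi * x * u ^ 2)) : ℝ) : ℂ) *
        (1 / (rho * x * u + ((m : ℂ) + 1)) ^ (s : ℂ) - 1 / ((m : ℂ) + 1) ^ (s : ℂ)) := by
  rw [← integral_gauss_complex, ← integral_mul_const, ← integral_add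
    ((integrable_gauss_complex hx).mul_const _) (integrable_inner_term hs hx m)]
  congr 1
  ext u
  ring

/-- The inner series may be integrated term by term. -/
theorem hasSum_integral_inner {s x : ℝ} (hs : 0 < s) (hx : 0 < x) :
    HasSum (fun m : ℕ => Complex.exp (-(Complex.I * Real.pi * ((m : ℂ) + 1) ^ 2 / x)) *
      ∫ u : ℝ, ((Real.exp (-(Real.pi * x * u ^ 2)) : ℝ) : ℂ) *
        (1 / (rho * x * u + ((m : ℂ) + 1)) ^ (s : ℂ) - 1 / ((m : ℂ) + 1) ^ (s : ℂ)))
      (∫ u : ℝ, ((Real.exp (-(Real.pi * x * u ^ 2)) : ℝ) : ℂ) * innerSeries s x u) := by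
  set F : ℕ → ℝ → ℂ := fun m u => Complex.exp (-(Complex.I * Real.pi * ((m : ℂ) + 1) ^ 2 / x)) *
    (((Real.exp (-(Real.pi * x * u ^ 2)) : ℝ) : ℂ) *
        (1 / (rho * x * u + ((m : ℂ) + 1)) ^ (s : ℂ) - 1 / ((m : ℂ) + 1) ^ (s : ℂ))) with hF
  have hFint : ∀ m, Integrable (F m) := fun m => (integrable_inner_term hs.le hx m).const_mul _
  have hunit : ∀ m : ℕ, ‖Complex.exp (-(Complex.I * Real.pi * ((m : ℂ) + 1) ^ 2 / x))‖ = 1 := by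
    intro m
    have e : -(Complex.I * Real.pi * ((m : ℂ) + 1) ^ 2 / x)
        = ((-(Real.pi * ((m : ℝ) + 1) ^ 2 / x) : ℝ) : ℂ) * Complex.I := by push_cast; ring
    rw [e, Complex.norm_exp_ofReal_mul_I]
  have hsum : Summable fun m : ℕ => ∫ u : ℝ, ‖F m u‖ := by
    have h1 : Summable fun m : ℕ => (1 / ((m : ℝ) + 1) ^ (s + 1)) := by
      have := (summable_nat_add_iff 1).2 (Real.summable_one_div_nat_rpow.2 (by linarith : 1 < s + 1))
      exact_mod_cast this
    refine Summable.of_nonneg_of_le (fun m => integral_nonneg fun u => norm_nonneg _) (fun m => ?_)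
      (h1.mul_right (s * x * 2 ^ (s + 1) * ∫ u : ℝ, Real.exp (-(Real.pi * x * u ^ 2)) * |u|))
    rw [← mul_assoc, ← integral_const_mul]
    refine integral_mono (hFint m).norm ((integrable_abs_mul_gauss hx).const_mul _) fun u => ?_
    simp only [hF]
    rw [norm_mul, hunit, one_mul, norm_mul, Complex.norm_real,
      Real.norm_of_nonneg (Real.exp_pos _).le]
    have := mul_le_mul_of_nonneg_left (norm_inner_term_le hs.le hx u m)
      (Real.exp_pos (-(Real.pi * x * u ^ 2))).le
    linarith
  have := hasSum_integral_of_summable_integral_norm hFint hsum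
  have e : ∫ u : ℝ, ((Real.exp (-(Real.pi * x * u ^ 2)) : ℝ) : ℂ) * innerSeries s x u =
      ∫ u : ℝ, ∑' m : ℕ, F m u := by
    congr 1
    ext u
    rw [innerSeries, ← tsum_mul_left]
    congr 1
    ext m
    simp only [hF]
    ring
  rw [e]
  simpa only [hF, integral_const_mul] using this

/-- Replacing `1/(ρxu + k)^s` by `1/k^s` leaves the Gaussian mass `x^{-1/2}`, which gives the
partial sum at `-1/x` the weight `x^{s-1/2}`. The differences are the terms of the inner series,
integrated one by one. -/
theorem sum_saddle {s x : ℝ} (hs : 0 < s) (hx : 0 < x) (K : ℕ) :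
    ∑ k ∈ Finset.range K, ∫ u : ℝ, kern s x (k + 1 : ℕ) ((((k : ℝ) + 1) / x : ℝ) + rho * u) =
      ((x ^ (s - 1 / 2) : ℝ) : ℂ) * partialF s (-1 / x) K +
      ((x ^ s : ℝ) : ℂ) * ∑ m ∈ Finset.range K,
        Complex.exp (-(Complex.I * Real.pi * ((m : ℂ) + 1) ^ 2 / x)) *
        ∫ u : ℝ, ((Real.exp (-(Real.pi * x * u ^ 2)) : ℝ) : ℂ) *
        (1 / (rho * x * u + ((m : ℂ) + 1)) ^ (s : ℂ) - 1 / ((m : ℂ) + 1) ^ (s : ℂ)) := by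
  have hpow : ((x ^ (s - 1 / 2) : ℝ) : ℂ) = ((x ^ s : ℝ) : ℂ) * ((√(1 / x) : ℝ) : ℂ) := by
    rw [← Complex.ofReal_mul, Real.rpow_sub hx, Real.sqrt_div zero_le_one, Real.sqrt_one,
      Real.sqrt_eq_rpow, mul_one_div]
  have hpart : partialF s (-1 / x) K = ∑ m ∈ Finset.range K,
      Complex.exp (-(Complex.I * Real.pi * ((m : ℂ) + 1) ^ 2 / x)) * (1 / ((m : ℂ) + 1) ^ (s : ℂ)) := by
    rw [partialF, sum_Icc_one_eq_sum_range]
    refine Finset.sum_congr rfl fun m _ => ?_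
    rw [Complex.ofReal_cpow (by positivity), mul_one_div]
    push_cast
    congr 2
    ring
  rw [hpow, hpart, mul_assoc, ← mul_add, Finset.mul_sum, ← Finset.sum_add_distrib, Finset.mul_sum]
  refine Finset.sum_congr rfl fun m _ => ?_
  rw [integral_kern_saddle hx, integral_gauss_mul_inv hs.le hx]
  ring

/-! ### The functional equation. -/

/-- The functional equation for `x > 0`. -/
theorem tendsto_partialF_of_pos {s x : ℝ} (hs : 0 < s) (hx : 0 < x) {F : ℂ}
    (hF : Tendsto (fun N => partialF s (-1 / x) N) atTop (𝓝 F)) :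
    Tendsto (fun N => partialF s x N) atTop
      (𝓝 (rho * ((x ^ (s - 1 / 2) : ℝ) : ℂ) * F + Ipos s x)) := by
  -- Exactly those terms are split off whose saddle point `k/x` does not lie beyond `N + 1/2`. This
  -- makes `|K N - x(N + 1/2)| ≤ 1`, as the remainder bound demands.
  set K : ℕ → ℕ := fun N => ⌊x * (N + 1 / 2)⌋₊ with hK
  have hKt : Tendsto K atTop atTop := by
    refine tendsto_nat_floor_atTop.comp ?_
    exact (tendsto_atTop_add_const_right _ _ tendsto_natCast_atTop_atTop).const_mul_atTop hx
  have hR : Tendsto (fun N : ℕ => mordell s x (K N) ((N : ℝ) + 1 / 2)) atTop (𝓝 0) := by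
    have h1 : Tendsto (fun N : ℕ => ((((N : ℝ) + 1 / 2) / 2) ^ s)⁻¹ *
      (2 * Real.exp (Real.pi / x) * ∫ u : ℝ, Real.exp (-(Real.pi * x / 2) * u ^ 2))) atTop (𝓝 0) := by
      have h2 : Tendsto (fun N : ℕ => ((N : ℝ) + 1 / 2) / 2) atTop atTop :=
        (tendsto_atTop_add_const_right _ _ tendsto_natCast_atTop_atTop).atTop_div_const (by norm_num)
      have h3 := ((tendsto_rpow_atTop hs).comp h2).inv_tendsto_atTop
      have h4 := h3.mul_const
        (2 * Real.exp (Real.pi / x) * ∫ u : ℝ, Real.exp (-(Real.pi * x / 2) * u ^ 2))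
      rw [zero_mul] at h4
      exact h4
    refine squeeze_zero_norm (fun N => ?_) h1
    refine norm_mordell_le (m := N) (by push_cast; ring) hs.le hx (by positivity) ?_
    have h4 := Nat.floor_le (a := x * ((N : ℝ) + 1 / 2)) (by positivity)
    have h5 := Nat.lt_floor_add_one (x * ((N : ℝ) + 1 / 2))
    rw [abs_le]
    simp only [hK]
    constructor <;> linarith
  have key : ∀ N : ℕ, partialF s x N = lineIntegral s x + rho * (((x ^ (s - 1 / 2) : ℝ) : ℂ) *
      partialF s (-1 / x) (K N) + ((x ^ s : ℝ) : ℂ) * ∑ m ∈ Finset.range (K N),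
        Complex.exp (-(Complex.I * Real.pi * ((m : ℂ) + 1) ^ 2 / x)) *
        ∫ u : ℝ, ((Real.exp (-(Real.pi * x * u ^ 2)) : ℝ) : ℂ) *
        (1 / (rho * x * u + ((m : ℂ) + 1)) ^ (s : ℂ) - 1 / ((m : ℂ) + 1) ^ (s : ℂ)))
      - mordell s x (K N) ((N : ℝ) + 1 / 2) := by
    intro N
    rw [sum_kern_eq_mordell_sub hs.le hx, lineIntegral_eq_mordell,
      mordell_eq_sub_sum (a := (N : ℝ) + 1 / 2) (m := N) (by push_cast; ring) hs.le hx
        (by positivity) (K N), ← sum_saddle hs hx, ← Finset.mul_sum]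
    rw [Finset.sum_congr rfl fun k _ => integral_kern_line_eq hs.le hx
      (a := (N : ℝ) + 1 / 2) (b := ((k : ℝ) + 1) / x) (κ := (k + 1 : ℕ)) (by positivity)
        (by positivity)]
    ring
  have hlim := (((hF.comp hKt).const_mul ((x ^ (s - 1 / 2) : ℝ) : ℂ)).add
    (((hasSum_integral_inner hs hx).tendsto_sum_nat.comp hKt).const_mul
      ((x ^ s : ℝ) : ℂ))).const_mul rho |>.const_add (lineIntegral s x) |>.sub hR
  refine (hlim.congr fun N => (key N).symm).trans (le_of_eq ?_)
  congr 1
  rw [Ipos]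
  ring

theorem conj_partialF (s x : ℝ) (N : ℕ) :
    (starRingEnd ℂ) (partialF s x N) = partialF s (-x) N := by
  rw [partialF, partialF, map_sum]
  refine Finset.sum_congr rfl fun k _ => ?_
  rw [map_div₀, ← Complex.exp_conj, Complex.conj_ofReal]
  congr 2
  simp

/-- The functional equation for `x ≠ 0`. -/
theorem tendsto_partialF {s x : ℝ} (hs : 0 < s) (hx : x ≠ 0) {F : ℂ}
    (hF : Tendsto (fun N => partialF s (-1 / x) N) atTop (𝓝 F)) :
    Tendsto (fun N => partialF s x N) atTop
      (𝓝 (Complex.exp (Complex.I * (Real.pi / 4) * ((Real.sign x : ℝ) : ℂ)) *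
        ((|x| ^ (s - 1 / 2) : ℝ) : ℂ) * F + Omega s x)) := by
  rcases hx.lt_or_gt with h | h
  · have h1 := tendsto_partialF_of_pos hs (neg_pos.2 h) (F := (starRingEnd ℂ) F) (by
      have := (Complex.continuous_conj.tendsto _).comp hF
      refine this.congr fun N => ?_
      simp only [Function.comp, conj_partialF]
      congr 1
      rw [neg_div, neg_neg, neg_div_neg_eq])
    have h2 := (Complex.continuous_conj.tendsto _).comp h1
    refine (h2.congr fun N => ?_).trans (le_of_eq ?_)
    · simp only [Function.comp, conj_partialF, neg_neg]
    · congr 1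
      rw [map_add, map_mul, map_mul, Complex.conj_conj, Complex.conj_ofReal, Omega,
        if_neg (not_lt.2 h.le), abs_of_neg h, Real.sign_of_neg h, rho, ← Complex.exp_conj]
      congr 4
      simp [Complex.conj_ofNat]
  · have h1 := tendsto_partialF_of_pos hs h hF
    rw [Omega, if_pos h, abs_of_pos h, Real.sign_of_pos h]
    simpa [rho] using h1

/-- `F_s` has period 2. -/
theorem partialF_add_two_mul_int (s x : ℝ) (n : ℤ) (N : ℕ) :
    partialF s (x + 2 * n) N = partialF s x N := by
  rw [partialF, partialF]
  refine Finset.sum_congr rfl fun k _ => ?_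
  congr 1
  have : Complex.I * Real.pi * (k : ℂ) ^ 2 * ((x + 2 * n : ℝ) : ℂ) =
      Complex.I * Real.pi * (k : ℂ) ^ 2 * x + 2 * Complex.I * Real.pi * ((k ^ 2 * n : ℤ) : ℂ) := by
    push_cast; ring
  rw [this, Complex.exp_add, exp_int_mul_two_pi_I', mul_one]

theorem partialF_T (s x : ℝ) (N : ℕ) : partialF s (T x) N = partialF s (-1 / x) N := by
  have := partialF_add_two_mul_int s (-1 / x) (-⌊(-1 / x + 1) / 2⌋) N
  rw [← this, T]
  congr 1
  push_cast; ring

/-! ### Weyl's inequality for quadratic exponential sums. -/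

/-- The exponential sum `∑_{k=1}^N e^{iπk²y}`. -/
def weylSum (y : ℝ) (N : ℕ) : ℂ :=
  ∑ k ∈ Finset.range N, Complex.exp (((Real.pi * ((k : ℝ) + 1) ^ 2 * y : ℝ) : ℂ) * Complex.I)

/-- The distance to the nearest integer. -/
def nint (t : ℝ) : ℝ := |t - round t|

theorem nint_le (t : ℝ) (n : ℤ) : nint t ≤ |t - n| := round_le t n

theorem two_mul_nint_le_abs_sin (t : ℝ) : 2 * nint t ≤ |Real.sin (Real.pi * t)| := by
  have h1 : |Real.sin (Real.pi * t)| = |Real.sin (Real.pi * (t - round t))| := by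
    rw [mul_sub, mul_comm Real.pi (round t : ℝ), Real.sin_sub_int_mul_pi, abs_mul]
    simp
  rw [h1]
  have h2 := abs_sub_round t
  have h3 := Real.mul_abs_le_abs_sin (x := Real.pi * (t - round t)) (by
    rw [abs_mul, abs_of_pos Real.pi_pos]
    nlinarith [Real.pi_pos])
  rw [abs_mul, abs_of_pos Real.pi_pos] at h3
  refine le_trans (le_of_eq ?_) h3
  rw [nint]
  field_simp

theorem norm_exp_sub_one_ge (t : ℝ) :
    4 * nint t ≤ ‖Complex.exp (((2 * Real.pi * t : ℝ) : ℂ) * Complex.I) - 1‖ := by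
  have h := Complex.norm_exp_I_mul_ofReal_sub_one (x := 2 * Real.pi * t)
  rw [mul_comm Complex.I] at h
  rw [h, show 2 * Real.pi * t / 2 = Real.pi * t by ring, norm_mul, Real.norm_eq_abs,
    Real.norm_eq_abs, abs_of_pos (by norm_num : (0 : ℝ) < 2)]
  linarith [two_mul_nint_le_abs_sin t]

/-- `min(N, 1 / (2‖t‖))`. -/
def peak (N t : ℝ) : ℝ := (max (1 / N) (2 * nint t))⁻¹

theorem peak_nonneg {N : ℝ} (hN : 0 < N) (t : ℝ) : 0 ≤ peak N t :=
  inv_nonneg.2 (le_max_of_le_left (by positivity))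

theorem norm_geom_sum_le {N : ℝ} (hN : 0 < N) (t : ℝ) {L : ℕ} (hL : (L : ℝ) ≤ N) :
    ‖∑ l ∈ Finset.range L, Complex.exp (((2 * Real.pi * t : ℝ) : ℂ) * Complex.I) ^ l‖ ≤ peak N t := by
  set w := Complex.exp (((2 * Real.pi * t : ℝ) : ℂ) * Complex.I) with hw
  have hw1 : ‖w‖ = 1 := Complex.norm_exp_ofReal_mul_I _
  set G := ‖∑ l ∈ Finset.range L, w ^ l‖ with hG
  have hG0 : 0 ≤ G := norm_nonneg _
  have h1 : G ≤ N := by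
    refine ((norm_sum_le _ _).trans ?_).trans hL
    simp [hw1]
  have h2 : 2 * nint t * G ≤ 1 := by
    have h3 : ‖w - 1‖ * G ≤ 2 := by
      rw [hG, ← norm_mul, mul_geom_sum]
      refine (norm_sub_le _ _).trans ?_
      rw [norm_pow, hw1, one_pow, norm_one]; norm_num
    have h4 := mul_le_mul_of_nonneg_right (norm_exp_sub_one_ge t) hG0
    linarith
  rw [peak, ← one_div, le_div_iff₀ (lt_max_of_lt_left (by positivity)),
    mul_max_of_nonneg _ _ hG0]
  refine max_le ?_ (by linarith)
  rw [mul_one_div, div_le_one hN]; exact h1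

/-- The square is expanded and the off-diagonal pairs are grouped by their difference `h + 1`; the
two orders of a pair are conjugate. -/
theorem norm_weylSum_sq_eq_aux (b : ℕ → ℂ) (N : ℕ) :
    ‖∑ k ∈ Finset.range N, b k‖ ^ 2 = ∑ k ∈ Finset.range N, ‖b k‖ ^ 2 +
      2 * (∑ h ∈ Finset.range N, ∑ l ∈ Finset.range (N - 1 - h),
        b (l + (h + 1)) * (starRingEnd ℂ) (b l)).re := by
  induction N with
  | zero => simp
  | succ N ih =>
    have h1 : ∑ h ∈ Finset.range (N + 1), ∑ l ∈ Finset.range (N + 1 - 1 - h),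
        b (l + (h + 1)) * (starRingEnd ℂ) (b l) =
        ∑ h ∈ Finset.range N, ∑ l ∈ Finset.range (N - 1 - h),
        b (l + (h + 1)) * (starRingEnd ℂ) (b l) +
        b N * (starRingEnd ℂ) (∑ k ∈ Finset.range N, b k) := by
      rw [Finset.sum_range_succ, show N + 1 - 1 - N = 0 by omega, Finset.sum_range_zero, add_zero,
        map_sum, Finset.mul_sum, ← Finset.sum_range_reflect (fun k => b N * (starRingEnd ℂ) (b k)),
        ← Finset.sum_add_distrib]
      refine Finset.sum_congr rfl fun h hh => ?_
      rw [Finset.mem_range] at hh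
      rw [show N + 1 - 1 - h = (N - 1 - h) + 1 by omega, Finset.sum_range_succ,
        show N - 1 - h + (h + 1) = N by omega]
    rw [h1, Finset.sum_range_succ, Finset.sum_range_succ, Complex.add_re, mul_add, add_comm (∑ k ∈ Finset.range N, b k),
      ← Complex.normSq_eq_norm_sq, Complex.normSq_add, Complex.normSq_eq_norm_sq,
      Complex.normSq_eq_norm_sq, ih]
    ring

/-- Weyl differencing: for a fixed difference the quadratic phase becomes linear, so each inner sum
is geometric with ratio `e^{2iπ(h+1)y}`, up to a unimodular factor. -/
theorem norm_weylSum_sq_le (y : ℝ) {N : ℕ} (hN : 0 < N) :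
    ‖weylSum y N‖ ^ 2 ≤ N + 2 * ∑ h ∈ Finset.range N, peak N (((h : ℝ) + 1) * y) := by
  have hN' : (0 : ℝ) < N := by exact_mod_cast hN
  rw [weylSum, norm_weylSum_sq_eq_aux]
  refine add_le_add (le_of_eq ?_) ?_
  · simp only [Complex.norm_exp_ofReal_mul_I]; simp
  refine mul_le_mul_of_nonneg_left ?_ (by norm_num)
  refine (Complex.re_le_norm _).trans ((norm_sum_le _ _).trans (Finset.sum_le_sum fun h hh => ?_))
  have hL : ((N - 1 - h : ℕ) : ℝ) ≤ N := by exact_mod_cast (by omega : N - 1 - h ≤ N)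
  refine le_trans (le_of_eq ?_) (norm_geom_sum_le hN' (((h : ℝ) + 1) * y) hL)
  have : ∀ l : ℕ, Complex.exp (((Real.pi * (((l + (h + 1) : ℕ) : ℝ) + 1) ^ 2 * y : ℝ) : ℂ) * Complex.I) *
      (starRingEnd ℂ) (Complex.exp (((Real.pi * ((l : ℝ) + 1) ^ 2 * y : ℝ) : ℂ) * Complex.I)) =
      Complex.exp (((Real.pi * (((h : ℝ) + 1) ^ 2 + 2 * (h + 1)) * y : ℝ) : ℂ) * Complex.I) *
      Complex.exp (((2 * Real.pi * (((h : ℝ) + 1) * y) : ℝ) : ℂ) * Complex.I) ^ l := by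
    intro l
    rw [← Complex.exp_conj, map_mul, Complex.conj_ofReal, Complex.conj_I, ← Complex.exp_nat_mul,
      ← Complex.exp_add, ← Complex.exp_add]
    congr 1
    push_cast; ring
  simp_rw [this]
  rw [← Finset.mul_sum, norm_mul, Complex.norm_exp_ofReal_mul_I, one_mul]

/-- Sum of `peak` over well spaced points whose signed residue has a given sign. -/
theorem sum_peak_le_of_sign {N : ℝ} (hN : 0 < N) {q : ℕ} (hq : 0 < q) {ε : ℝ} (hε : |ε| = 1)
    (S : Finset ℕ) (z : ℕ → ℝ) (hpos : ∀ i ∈ S, 0 ≤ ε * (z i - round (z i)))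
    (hsp : ∀ i ∈ S, ∀ j ∈ S, i ≠ j → 1 / (2 * (q : ℝ)) ≤ nint (z i - z j)) :
    ∑ i ∈ S, peak N (z i) ≤ N + q * (1 + Real.log q) := by
  have hq' : (0 : ℝ) < q := by exact_mod_cast hq
  -- Residues on one side of `0` are sorted into cells of length `1/(2q)`. By the spacing each cell
  -- holds at most one point, and the cells are numbered `0, …, q` since a residue is at most `1/2`.
  -- Cell `0` costs `N`, cell `j` costs `q/j`, and the harmonic sum gives the logarithm.
  set f : ℕ → ℕ := fun i => ⌊2 * q * (ε * (z i - round (z i)))⌋₊ with hf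
  set Ψ : ℕ → ℝ := fun j => if j = 0 then N else q / j with hΨ
  have hΨ0 : ∀ j, 0 ≤ Ψ j := by intro j; simp only [hΨ]; split_ifs <;> positivity
  have hr : ∀ i ∈ S, ε * (z i - round (z i)) = nint (z i) := by
    intro i hi
    rw [← abs_of_nonneg (hpos i hi), abs_mul, hε, one_mul, nint]
  have hinj : Set.InjOn f S := by
    intro i hi j hj hij
    by_contra hne
    have h1 := hsp i hi j hj hne
    have h2 := nint_le (z i - z j) (round (z i) - round (z j))
    have h3 : |2 * q * (ε * (z i - round (z i))) - 2 * q * (ε * (z j - round (z j)))| < 1 := by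
      have a1 := Nat.floor_le (mul_nonneg (by positivity : (0 : ℝ) ≤ 2 * q) (hpos i hi))
      have a2 := Nat.lt_floor_add_one (2 * q * (ε * (z i - round (z i))))
      have a3 := Nat.floor_le (mul_nonneg (by positivity : (0 : ℝ) ≤ 2 * q) (hpos j hj))
      have a4 := Nat.lt_floor_add_one (2 * q * (ε * (z j - round (z j))))
      simp only [hf] at hij
      rw [hij] at a1 a2
      rw [abs_lt]; constructor <;> linarith
    have h4 : |2 * q * (ε * (z i - round (z i))) - 2 * q * (ε * (z j - round (z j)))| =
        2 * q * |z i - z j - ((round (z i) - round (z j) : ℤ) : ℝ)| := by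
      rw [show 2 * q * (ε * (z i - round (z i))) - 2 * q * (ε * (z j - round (z j))) =
        (2 * q) * (ε * (z i - z j - ((round (z i) - round (z j) : ℤ) : ℝ))) by push_cast; ring,
        abs_mul (2 * (q : ℝ)), abs_mul ε, hε, one_mul, abs_of_pos (by positivity : (0 : ℝ) < 2 * q)]
    rw [h4] at h3
    have h5 : 2 * q * (1 / (2 * (q : ℝ))) ≤ 2 * q * |z i - z j - ((round (z i) - round (z j) : ℤ) : ℝ)| :=
      mul_le_mul_of_nonneg_left (h1.trans h2) (by positivity)
    rw [mul_one_div_cancel (by positivity)] at h5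
    linarith
  have hle : ∀ i ∈ S, peak N (z i) ≤ Ψ (f i) := by
    intro i hi
    simp only [hΨ]
    split_ifs with h0
    · rw [peak]
      calc (max (1 / N) (2 * nint (z i)))⁻¹ ≤ (1 / N)⁻¹ := inv_anti₀ (by positivity) (le_max_left _ _)
        _ = N := by simp
    · have h1 := Nat.floor_le (mul_nonneg (by positivity : (0 : ℝ) ≤ 2 * q) (hpos i hi))
      have hfp : (0 : ℝ) < f i := by exact_mod_cast Nat.pos_of_ne_zero h0
      have h2 : (f i : ℝ) / q ≤ 2 * nint (z i) := by
        rw [div_le_iff₀ hq', ← hr i hi]; simp only [hf]; linarith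
      rw [peak]
      calc (max (1 / N) (2 * nint (z i)))⁻¹ ≤ ((f i : ℝ) / q)⁻¹ :=
            inv_anti₀ (by positivity) (h2.trans (le_max_right _ _))
        _ = q / f i := inv_div _ _
  have hsub : S.image f ⊆ Finset.range (q + 1) := by
    intro j hj
    obtain ⟨i, hi, rfl⟩ := Finset.mem_image.1 hj
    rw [Finset.mem_range, Nat.lt_add_one_iff]
    refine Nat.floor_le_of_le ?_
    have h1 := abs_sub_round (z i)
    rw [hr i hi, nint]
    nlinarith
  have hharm : ∑ j ∈ Finset.range q, (1 / ((j : ℝ) + 1)) ≤ 1 + Real.log q := by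
    have h1 := harmonic_le_one_add_log q
    rw [harmonic] at h1
    push_cast at h1
    simpa [one_div] using h1
  calc ∑ i ∈ S, peak N (z i) ≤ ∑ i ∈ S, Ψ (f i) := Finset.sum_le_sum hle
    _ = ∑ j ∈ S.image f, Ψ j := (Finset.sum_image hinj).symm
    _ ≤ ∑ j ∈ Finset.range (q + 1), Ψ j :=
        Finset.sum_le_sum_of_subset_of_nonneg hsub fun j _ _ => hΨ0 j
    _ = q * ∑ j ∈ Finset.range q, (1 / ((j : ℝ) + 1)) + N := by
        rw [Finset.sum_range_succ', Finset.mul_sum]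
        simp [hΨ, div_eq_mul_inv]
    _ ≤ _ := by nlinarith

theorem sum_peak_le {N : ℝ} (hN : 0 < N) {q : ℕ} (hq : 0 < q) (m : ℕ) (z : ℕ → ℝ)
    (hsp : ∀ i < m, ∀ j < m, i ≠ j → 1 / (2 * (q : ℝ)) ≤ nint (z i - z j)) :
    ∑ i ∈ Finset.range m, peak N (z i) ≤ 2 * (N + q * (1 + Real.log q)) := by
  classical
  rw [← Finset.sum_filter_add_sum_filter_not (Finset.range m) (fun i => 0 ≤ z i - round (z i)), two_mul]
  have hm : ∀ {p : ℕ → Prop} [DecidablePred p] {i}, i ∈ (Finset.range m).filter p → i < m :=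
    fun hi => Finset.mem_range.1 (Finset.mem_filter.1 hi).1
  refine add_le_add ?_ ?_
  · refine sum_peak_le_of_sign hN hq (ε := 1) (by simp) _ z (fun i hi => ?_)
      fun i hi j hj hij => hsp i (hm hi) j (hm hj) hij
    rw [one_mul]; exact (Finset.mem_filter.1 hi).2
  · refine sum_peak_le_of_sign hN hq (ε := -1) (by simp) _ z (fun i hi => ?_)
      fun i hi j hj hij => hsp i (hm hi) j (hm hj) hij
    have := (Finset.mem_filter.1 hi).2
    linarith

/-- As `i` is not a multiple of the denominator `q` of `r`, the number `i r` is at distance at least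
`1/q` from every integer. Replacing `r` by `y` moves it by at most `N/((2N + 1)q)`, which is below
half of that. -/
theorem le_nint_mul {y : ℝ} {N : ℕ} {r : ℚ} (hr : |y - r| ≤ 1 / ((2 * N + 1) * r.den)) {i : ℤ}
    (hi0 : i ≠ 0) (hiq : |i| < r.den) (hiN : |i| ≤ N) : 1 / (2 * (r.den : ℝ)) ≤ nint (i * y) := by
  have hq : (0 : ℝ) < r.den := by exact_mod_cast r.den_pos
  rw [nint]
  set n := round ((i : ℝ) * y)
  have hne : i * r.num - n * r.den ≠ 0 := by
    intro h
    have h1 : (r.den : ℤ) ∣ i * r.num := ⟨n, by linarith⟩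
    have h2 : IsCoprime (r.den : ℤ) r.num := by
      rw [Int.isCoprime_iff_gcd_eq_one, Int.gcd_comm]; exact_mod_cast r.reduced
    have h3 := h2.dvd_of_dvd_mul_right h1
    have h4 := Int.le_of_dvd (abs_pos.2 hi0) ((dvd_abs _ _).2 h3)
    omega
  have h1 : (1 : ℝ) ≤ |(i : ℝ) * r.num - n * r.den| := by
    have := Int.one_le_abs hne
    exact_mod_cast this
  have h2 : (i : ℝ) * r.num - n * r.den = r.den * ((i * y - n) - i * (y - r)) := by
    have : (r : ℝ) * r.den = r.num := by exact_mod_cast Rat.mul_den_eq_num r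
    rw [← this]; ring
  have h3 : |(i : ℝ) * (y - r)| ≤ 1 / (2 * r.den) := by
    rw [abs_mul]
    have hi' : |(i : ℝ)| ≤ N := by exact_mod_cast hiN
    calc |(i : ℝ)| * |y - r| ≤ N * (1 / ((2 * N + 1) * r.den)) := by gcongr
      _ ≤ 1 / (2 * r.den) := by
        rw [mul_one_div, div_le_div_iff₀ (by positivity) (by positivity)]
        nlinarith
  rw [h2, abs_mul, abs_of_pos hq] at h1
  have h4 := abs_sub (i * y - n) ((i : ℝ) * (y - r))
  have h5 : 1 / (r.den : ℝ) ≤ |(i * y - n) - i * (y - r)| := by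
    rw [div_le_iff₀ hq]; linarith
  have h6 : 1 / (r.den : ℝ) = 1 / (2 * r.den) + 1 / (2 * r.den) := by field_simp; norm_num
  linarith

/-- Weyl's inequality. -/
theorem norm_weylSum_sq_le_of_approx {y : ℝ} {N : ℕ} (hN : 0 < N) {r : ℚ}
    (hr : |y - r| ≤ 1 / ((2 * N + 1) * r.den)) (hrN : r.den ≤ 2 * N) :
    ‖weylSum y N‖ ^ 2 ≤ 33 * ((N : ℝ) ^ 2 / r.den + N * (1 + Real.log N)) := by
  have hN' : (1 : ℝ) ≤ N := by exact_mod_cast hN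
  set q := r.den with hq
  have hq0 : 0 < q := r.den_pos
  have hq' : (1 : ℝ) ≤ q := by exact_mod_cast hq0
  have hqN : (q : ℝ) ≤ 2 * N := by exact_mod_cast hrN
  -- The differences are cut into blocks of length `m`: at most `q`, so that distinct indices of a
  -- block differ modulo `q`, and at most `N`, so that `le_nint_mul` applies to their difference.
  set m := min q N with hm
  have hm0 : 0 < m := lt_min hq0 hN
  have hm' : (0 : ℝ) < m := by exact_mod_cast hm0
  set W : ℝ := 2 * (N + q * (1 + Real.log q)) with hW
  have hlogq : 0 ≤ Real.log q := Real.log_nonneg hq'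
  have hW0 : 0 ≤ W := by positivity
  have hblocks : ∀ B : ℕ, ∑ h ∈ Finset.range (m * B), peak N (((h : ℝ) + 1) * y) ≤ B * W := by
    intro B
    induction B with
    | zero => simp
    | succ B ih =>
      rw [Nat.mul_succ, Finset.sum_range_add]
      have := sum_peak_le (N := N) (by linarith) hq0 m
        (fun i => (((m * B + i : ℕ) : ℝ) + 1) * y) (by
          intro i hi j hj hij
          have e : (((m * B + i : ℕ) : ℝ) + 1) * y - (((m * B + j : ℕ) : ℝ) + 1) * y
              = ((i - j : ℤ) : ℝ) * y := by push_cast; ring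
          simp only [e]
          have h1 : m ≤ q := min_le_left _ _
          have h2 : m ≤ N := min_le_right _ _
          refine le_nint_mul hr (by omega) ?_ ?_
          · rw [abs_lt]; omega
          · rw [abs_le]; omega)
      push_cast at this ⊢
      linarith
  have hcover : ∑ h ∈ Finset.range N, peak N (((h : ℝ) + 1) * y) ≤ (N / m + 1 : ℕ) * W := by
    refine le_trans ?_ (hblocks (N / m + 1))
    refine Finset.sum_le_sum_of_subset_of_nonneg ?_ fun h _ _ => peak_nonneg (by linarith) _
    rw [Finset.range_subset_range]
    have := Nat.lt_mul_div_succ N hm0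
    omega
  -- The assumption `q ≤ 2N` gives `m ≥ q/2`, whichever of `q` and `N` is smaller.
  have hB : ((N / m + 1 : ℕ) : ℝ) ≤ 4 * N / q := by
    have h1 : ((N / m : ℕ) : ℝ) ≤ N / m := Nat.cast_div_le
    have h2 : (1 : ℝ) ≤ N / m := by
      rw [le_div_iff₀ hm', one_mul]; exact_mod_cast min_le_right q N
    have h3 : (q : ℝ) / 2 ≤ m := by
      rw [hm]; push_cast
      exact le_min (by linarith) (by linarith)
    have h4 : (N : ℝ) / m ≤ N / (q / 2) := div_le_div_of_nonneg_left (by linarith) (by linarith) h3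
    push_cast
    have h5 : (N : ℝ) / (q / 2) = 2 * N / q := by field_simp
    have h6 : 4 * (N : ℝ) / q = 2 * N / q + 2 * N / q := by ring
    linarith
  have hlog : Real.log q ≤ 1 + Real.log N := by
    have h1 : Real.log q ≤ Real.log (2 * N) := Real.log_le_log (by linarith) hqN
    rw [Real.log_mul (by norm_num) (by linarith)] at h1
    linarith [Real.log_two_lt_d9]
  have hmain := norm_weylSum_sq_le y hN
  have h7 : ((N / m + 1 : ℕ) : ℝ) * W ≤ 4 * N / q * W := mul_le_mul_of_nonneg_right hB hW0
  have h8 : 4 * N / q * W = 8 * ((N : ℝ) ^ 2 / q) + 8 * N * (1 + Real.log q) := by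
    rw [hW]; field_simp; ring
  have h9 : (N : ℝ) * Real.log q ≤ N * (1 + Real.log N) :=
    mul_le_mul_of_nonneg_left hlog (by linarith)
  have h10 : 0 ≤ (N : ℝ) * Real.log N := mul_nonneg (by linarith) (Real.log_nonneg hN')
  have h11 : 0 ≤ (N : ℝ) ^ 2 / q := by positivity
  nlinarith

theorem norm_weylSum_le (y : ℝ) (N : ℕ) : ‖weylSum y N‖ ≤ N := by
  refine (norm_sum_le _ _).trans ?_
  simp only [Complex.norm_exp_ofReal_mul_I]; simp

/-! ### Least denominators of good approximations. -/

/-- The least denominator `q ≥ 1` with `‖qx‖ ≤ 1 / M`. -/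
def minDen (x M : ℝ) : ℕ := sInf {q : ℕ | 1 ≤ q ∧ ∃ p : ℤ, |q * x - p| ≤ 1 / M}

theorem minDen_set_nonempty (x : ℝ) {M : ℝ} (hM : 0 < M) :
    {q : ℕ | 1 ≤ q ∧ ∃ p : ℤ, |q * x - p| ≤ 1 / M}.Nonempty := by
  have hn : 0 < ⌈M⌉₊ := Nat.ceil_pos.2 hM
  obtain ⟨p, k, hk, -, h⟩ := Real.exists_int_int_abs_mul_sub_le x hn
  refine ⟨k.toNat, by omega, p, ?_⟩
  have e : ((k.toNat : ℕ) : ℝ) = k := by exact_mod_cast Int.toNat_of_nonneg hk.le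
  rw [e]
  refine h.trans (one_div_le_one_div_of_le hM ?_)
  linarith [Nat.le_ceil M]

theorem one_le_minDen (x : ℝ) {M : ℝ} (hM : 0 < M) : 1 ≤ minDen x M :=
  (Nat.sInf_mem (minDen_set_nonempty x hM)).1

theorem exists_minDen (x : ℝ) {M : ℝ} (hM : 0 < M) :
    ∃ p : ℤ, |minDen x M * x - p| ≤ 1 / M :=
  (Nat.sInf_mem (minDen_set_nonempty x hM)).2

theorem minDen_le_abs {x M : ℝ} {q p : ℤ} (hq : q ≠ 0) (h : |q * x - p| ≤ 1 / M) :
    (minDen x M : ℝ) ≤ |(q : ℝ)| := by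
  have h1 : minDen x M ≤ q.natAbs := by
    refine Nat.sInf_le ⟨Int.natAbs_pos.2 hq, ?_⟩
    have e : ((q.natAbs : ℕ) : ℝ) = |(q : ℝ)| := by
      rw [Nat.cast_natAbs]; push_cast; rfl
    rw [e]
    rcases le_total 0 (q : ℝ) with h0 | h0
    · exact ⟨p, by rwa [abs_of_nonneg h0]⟩
    · refine ⟨-p, ?_⟩
      rw [abs_of_nonpos h0, ← abs_neg]
      convert h using 2
      push_cast; ring
  have h2 : ((minDen x M : ℕ) : ℝ) ≤ (q.natAbs : ℕ) := by exact_mod_cast h1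
  rwa [Nat.cast_natAbs, Int.cast_abs] at h2

theorem minDen_mono (x : ℝ) {M M' : ℝ} (hM : 0 < M) (h : M ≤ M') : minDen x M ≤ minDen x M' := by
  obtain ⟨p, hp⟩ := exists_minDen x (hM.trans_le h)
  exact Nat.sInf_le ⟨one_le_minDen x (hM.trans_le h), p, hp.trans (one_div_le_one_div_of_le hM h)⟩

/-! ### The orbit of `T` as unimodular images, and transport of approximations. -/

/-- `x` is the image of `y` under the unimodular matrix `(a, b; c, d)`, where `|c| < |d|`. -/
structure IsOrbit (x y : ℝ) (a b c d : ℤ) : Prop where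
  det : a * d - b * c = 1
  lt : |c| < |d|
  irr : Irrational y
  abs_lt_one : |y| < 1
  eq : x * (c * y + d) = a * y + b

theorem irrational_T {y : ℝ} (hy : Irrational y) : Irrational (T y) := by
  have h1 : Irrational (-1 / y) := by
    rw [neg_div, one_div]; exact hy.inv.neg
  have := h1.sub_intCast (2 * ⌊(-1 / y + 1) / 2⌋)
  push_cast at this
  exact this

theorem T_mem (y : ℝ) : -1 ≤ T y ∧ T y < 1 := by
  have h1 := Int.floor_le ((-1 / y + 1) / 2)
  have h2 := Int.lt_floor_add_one ((-1 / y + 1) / 2)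
  rw [T]
  constructor <;> linarith

theorem abs_T_lt_one {y : ℝ} (hy : Irrational y) : |T y| < 1 := by
  refine abs_lt.2 ⟨lt_of_le_of_ne (T_mem y).1 ?_, (T_mem y).2⟩
  have := (irrational_T hy).ne_int (-1)
  push_cast at this
  exact this.symm

/-- Here `y = -1/(T y + 2k)`, which multiplies the matrix on the right by `(0, -1; 1, 2k)` up to an
overall sign. -/
theorem IsOrbit.step {x y : ℝ} {a b c d : ℤ} (h : IsOrbit x y a b c d) :
    IsOrbit x (T y) b (2 * ⌊(-1 / y + 1) / 2⌋ * b - a) d (2 * ⌊(-1 / y + 1) / 2⌋ * d - c) := by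
  set k := ⌊(-1 / y + 1) / 2⌋ with hk
  have hy0 : y ≠ 0 := h.irr.ne_zero
  have hT : T y = -1 / y - 2 * k := rfl
  have hT1 := abs_T_lt_one h.irr
  -- If `k = 0`, then `|T y| = 1/|y| > 1`. With `|k| ≥ 1` the new entry satisfies `|2kd - c| ≥ 2|d|
  -- - |c| > |d|`, so the strict inequality between the lower entries persists.
  have hk0 : k ≠ 0 := by
    intro h0
    rw [hT, h0, Int.cast_zero, mul_zero, sub_zero, abs_div, abs_neg, abs_one,
      div_lt_one (abs_pos.2 hy0)] at hT1
    linarith [h.abs_lt_one]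
  refine ⟨by linear_combination h.det, ?_, irrational_T h.irr, hT1, ?_⟩
  · have h1 := abs_sub_abs_le_abs_sub (2 * k * d) c
    have h2 : 2 * |d| ≤ |2 * k * d| := by
      rw [abs_mul, abs_mul]
      have := Int.one_le_abs hk0
      have h3 : |(2 : ℤ)| = 2 := rfl
      rw [h3]
      nlinarith [abs_nonneg d]
    linarith [h.lt]
  · have h1 := h.eq
    push_cast
    rw [hT]
    field_simp
    linear_combination -h1

theorem IsOrbit.mul_eq_one {x y : ℝ} {a b c d : ℤ} (h : IsOrbit x y a b c d) :
    |(a : ℝ) - c * x| * |(c : ℝ) * y + d| = 1 := by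
  have h1 : (a : ℝ) * d - b * c = 1 := by exact_mod_cast h.det
  rw [← abs_mul]
  have : ((a : ℝ) - c * x) * (c * y + d) = 1 := by linear_combination h1 - c * h.eq
  rw [this, abs_one]

/-- A step replaces `a - cx` by `b - dx = -y(a - cx)`, so its modulus is the orbit product. The new
`|c|` is the old `|d| > |c|`, whence growth by at least one. -/
theorem exists_isOrbit {x : ℝ} (hx : Irrational x) (hx1 : |x| < 1) (J : ℕ) :
    ∃ a b c d : ℤ, IsOrbit x (T^[J] x) a b c d ∧ (J : ℤ) ≤ |c| ∧
      absProd x J = |(a : ℝ) - c * x| := by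
  induction J with
  | zero =>
    refine ⟨1, 0, 0, 1, ⟨by norm_num, by norm_num, hx, hx1, by simp⟩, by simp, ?_⟩
    simp [absProd]
  | succ J ih =>
    obtain ⟨a, b, c, d, h, hJ, hp⟩ := ih
    refine ⟨_, _, _, _, Function.iterate_succ_apply' T J x ▸ h.step, ?_, ?_⟩
    · have := h.lt; push_cast; omega
    · rw [absProd, Finset.prod_range_succ, abs_mul, ← absProd, hp, ← abs_mul, ← abs_neg]
      congr 1
      linear_combination h.eq

theorem abs_add_mul_eq {c d t : ℝ} (hcd : c * d ≤ 0) (h : |c| ≤ |d|) (ht0 : 0 ≤ t) (ht : t ≤ 1) :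
    |d + c * t| = |d| - |c| * t := by
  rcases le_total 0 d with hd | hd
  · rcases hd.eq_or_lt with rfl | hd'
    · have : c = 0 := by simpa using h
      simp [this]
    · have hc : c ≤ 0 := by
        by_contra hc; push Not at hc
        nlinarith [mul_pos hc hd']
      rw [abs_of_nonneg hd, abs_of_nonpos hc] at *
      rw [abs_of_nonneg (by nlinarith)]; ring
  · rcases hd.eq_or_lt with rfl | hd'
    · have : c = 0 := by simpa using h
      simp [this]
    · have hc : 0 ≤ c := by
        by_contra hc; push Not at hc
        nlinarith [mul_pos_of_neg_of_neg hc hd']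
      rw [abs_of_nonpos hd, abs_of_nonneg hc] at *
      rw [abs_of_nonpos (by nlinarith)]; ring

theorem le_abs_add_mul {c d t : ℝ} (hcd : 0 ≤ c * d) (ht0 : 0 ≤ t) : |d| ≤ |d + c * t| := by
  rw [← sq_le_sq]
  nlinarith [mul_nonneg hcd ht0, sq_nonneg (c * t)]

/-- In each sign case an explicit denominator is admissible for `M = |c|`: either `c` or `c + d`.
Even at slow steps of the orbit, where `y` is near `±1`, one of them is small enough. -/
theorem minDen_mul_le_one_of_nonneg {x y : ℝ} {a b c d : ℤ} (hlt : |c| < |d|) (hy0 : 0 ≤ y)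
    (hy1 : y < 1) (heq : x * (c * y + d) = a * y + b) (hc : c ≠ 0)
    (hone : |(a : ℝ) - c * x| * |(c : ℝ) * y + d| = 1) :
    |(a : ℝ) - c * x| * minDen x |(c : ℝ)| ≤ 1 := by
  have hlt' : |(c : ℝ)| < |(d : ℝ)| := by exact_mod_cast hlt
  have hc0 : 0 < |(c : ℝ)| := abs_pos.2 (by exact_mod_cast hc)
  set θ := |(a : ℝ) - c * x| with hθ
  have hθ0 : 0 ≤ θ := abs_nonneg _
  rw [add_comm, mul_comm (c : ℝ) y, mul_comm y] at hone
  -- For equal signs `|cy + d| ≥ |d| > |c|`, hence `θ|c| ≤ 1` and `c` serves. For opposite signs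
  -- `|cy + d| = |d| - |c|y`, and `c + d`, of size `|d| - |c|`, has error `(1 - y)θ ≤ 1/|c|`.
  rcases le_total 0 ((c : ℝ) * d) with hcd | hcd
  · have h1 := le_abs_add_mul hcd hy0
    have h2 : θ * |(d : ℝ)| ≤ 1 := (mul_le_mul_of_nonneg_left h1 hθ0).trans hone.le
    have h3 : (minDen x |(c : ℝ)| : ℝ) ≤ |(c : ℝ)| := by
      refine minDen_le_abs (p := a) hc ?_
      rw [abs_sub_comm, ← hθ, le_div_iff₀ hc0]
      nlinarith
    nlinarith
  · rw [abs_add_mul_eq hcd hlt'.le hy0 hy1.le] at hone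
    have e1 := abs_add_mul_eq hcd hlt'.le zero_le_one le_rfl
    rw [mul_one, mul_one] at e1
    have hQ : d + c ≠ 0 := by
      intro h
      have : (d : ℝ) + c = 0 := by exact_mod_cast h
      rw [this, abs_zero] at e1
      linarith
    have h3 : (minDen x |(c : ℝ)| : ℝ) ≤ |((d + c : ℤ) : ℝ)| := by
      refine minDen_le_abs (p := a + b) hQ ?_
      have e2 : ((d + c : ℤ) : ℝ) * x - ((a + b : ℤ) : ℝ) = (y - 1) * ((a : ℝ) - c * x) := by
        push_cast; linear_combination heq
      rw [e2, abs_mul, ← hθ, abs_of_nonpos (by linarith), le_div_iff₀ hc0]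
      nlinarith
    push_cast at h3
    rw [e1] at h3
    have h4 : θ * (minDen x |(c : ℝ)| : ℝ) ≤ θ * (|(d : ℝ)| - |(c : ℝ)|) :=
      mul_le_mul_of_nonneg_left h3 hθ0
    have h5 : |(c : ℝ)| * y ≤ |(c : ℝ)| := by nlinarith
    nlinarith

/-- Negative `y` reduces to the previous case on replacing `(y, a, c)` by `(-y, -a, -c)`. The
determinant changes sign, but only the product of absolute values enters. -/
theorem IsOrbit.minDen_mul_le_one {x y : ℝ} {a b c d : ℤ} (h : IsOrbit x y a b c d) (hc : c ≠ 0) :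
    |(a : ℝ) - c * x| * minDen x |(c : ℝ)| ≤ 1 := by
  have hy := abs_lt.1 h.abs_lt_one
  rcases le_total 0 y with h0 | h0
  · exact minDen_mul_le_one_of_nonneg h.lt h0 hy.2 h.eq hc h.mul_eq_one
  · have e : |((-a : ℤ) : ℝ) - (-c : ℤ) * x| = |(a : ℝ) - c * x| := by
      rw [← abs_neg]; congr 1; push_cast; ring
    have e1 : |((-c : ℤ) : ℝ)| = |(c : ℝ)| := by push_cast; exact abs_neg _
    have := minDen_mul_le_one_of_nonneg (x := x) (y := -y) (a := -a) (b := b) (c := -c) (d := d)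
      (by rw [abs_neg]; exact h.lt) (by linarith) (by linarith)
      (by push_cast; linear_combination h.eq) (neg_ne_zero.2 hc) (by
        rw [e, ← h.mul_eq_one]; congr 2; push_cast; ring)
    rwa [e, e1] at this

/-- The matrix sends `p/q` near `y` to `P/Q` near `x`, and the error `qy - p` is multiplied by `a -
cx`. Moreover `Q = q(cy + d) - c(qy - p)`, so `θ|Q| ≤ q + 1/2`, because `θ|cy + d| = 1`. -/
theorem IsOrbit.minDen_le_of_approx {x y : ℝ} {a b c d : ℤ} (h : IsOrbit x y a b c d) {N : ℕ}
    (hN : 1 ≤ N) (hθ1 : |(a : ℝ) - c * x| ≤ 1) (hcN : |(c : ℝ)| * |(a : ℝ) - c * x| ≤ N) {q p : ℤ}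
    (hq : 1 ≤ q) (hp : |q * y - p| ≤ 1 / (2 * N)) :
    |(a : ℝ) - c * x| * minDen x (N / |(a : ℝ) - c * x|) ≤ 3 / 2 * q := by
  have hone := h.mul_eq_one
  set θ := |(a : ℝ) - c * x| with hθ
  have hN' : (1 : ℝ) ≤ N := by exact_mod_cast hN
  have hq' : (1 : ℝ) ≤ q := by exact_mod_cast hq
  have hθ0 : 0 < θ := by
    rcases (abs_nonneg ((a : ℝ) - c * x)).eq_or_lt with h0 | h0
    · rw [hθ, ← h0, zero_mul] at hone; norm_num at hone
    · exact h0
  set Q : ℤ := c * p + d * q with hQdef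
  set P : ℤ := a * p + b * q with hPdef
  have e1 : (Q : ℝ) * x - P = (q * y - p) * ((a : ℝ) - c * x) := by
    rw [hQdef, hPdef]; push_cast; linear_combination q * h.eq
  have e2 : |(Q : ℝ) * x - P| ≤ θ / (2 * N) := by
    rw [e1, abs_mul, ← hθ]
    calc |q * y - p| * θ ≤ 1 / (2 * N) * θ := mul_le_mul_of_nonneg_right hp hθ0.le
      _ = θ / (2 * N) := by ring
  -- If `Q = 0`, then `P` is an integer of modulus below `1`, hence `0`; inverting the matrix gives
  -- `q = aQ - cP = 0`.
  have hQ0 : Q ≠ 0 := by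
    intro hQ
    rw [hQ, Int.cast_zero, zero_mul, zero_sub, abs_neg] at e2
    have h1 : |(P : ℝ)| < 1 := by
      refine e2.trans_lt ?_
      rw [div_lt_one (by positivity)]; linarith
    have hP : P = 0 := by
      have : |P| < 1 := by exact_mod_cast h1
      exact Int.abs_lt_one_iff.1 this
    have h2 : a * Q - c * P = q := by
      rw [hQdef, hPdef]; linear_combination q * h.det
    rw [hQ, hP] at h2
    omega
  have h3 : (minDen x (N / θ) : ℝ) ≤ |(Q : ℝ)| := by
    refine minDen_le_abs (p := P) hQ0 (e2.trans ?_)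
    rw [one_div_div]
    exact div_le_div_of_nonneg_left hθ0.le (by linarith) (by linarith)
  have h4 : |(Q : ℝ)| ≤ q * |(c : ℝ) * y + d| + |(c : ℝ)| * (1 / (2 * N)) := by
    have e3 : (Q : ℝ) = q * (c * y + d) - c * (q * y - p) := by
      rw [hQdef]; push_cast; ring
    rw [e3]
    refine (abs_sub _ _).trans ?_
    rw [abs_mul, abs_mul (c : ℝ), abs_of_pos (by linarith : (0 : ℝ) < q)]
    gcongr
  have h5 : θ * (|(c : ℝ)| * (1 / (2 * N))) ≤ 1 / 2 := by
    rw [← mul_assoc, mul_one_div, div_le_div_iff₀ (by positivity) (by norm_num)]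
    linarith
  calc θ * (minDen x (N / θ) : ℝ) ≤ θ * (q * |(c : ℝ) * y + d| + |(c : ℝ)| * (1 / (2 * N))) :=
        mul_le_mul_of_nonneg_left (h3.trans h4) hθ0.le
    _ = q * (θ * |(c : ℝ) * y + d|) + θ * (|(c : ℝ)| * (1 / (2 * N))) := by ring
    _ ≤ q * 1 + 1 / 2 := by rw [hone]; linarith
    _ ≤ _ := by linarith

/-- Weyl's inequality along the orbit of `x`, in terms of the diophantine properties of `x`. -/
theorem IsOrbit.norm_weylSum_le {x y : ℝ} {a b c d : ℤ} (h : IsOrbit x y a b c d) {N : ℕ}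
    (hN : 1 ≤ N) (hθ1 : |(a : ℝ) - c * x| ≤ 1) :
    ‖weylSum y N‖ ≤ 8 * (N / √(|(a : ℝ) - c * x| * minDen x (N / |(a : ℝ) - c * x|)) +
      √(N * (1 + Real.log N))) := by
  have hone := h.mul_eq_one
  have hmin := h.minDen_mul_le_one
  have happ := h.minDen_le_of_approx hN hθ1
  set θ := |(a : ℝ) - c * x| with hθ
  have hN' : (1 : ℝ) ≤ N := by exact_mod_cast hN
  have hθ0 : 0 < θ := by
    rcases (abs_nonneg ((a : ℝ) - c * x)).eq_or_lt with h0 | h0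
    · rw [hθ, ← h0, zero_mul] at hone; norm_num at hone
    · exact h0
  have hψ : (1 : ℝ) ≤ minDen x (N / θ) := by
    exact_mod_cast one_le_minDen x (by positivity : (0 : ℝ) < N / θ)
  set D : ℝ := θ * minDen x (N / θ) with hD
  have hD0 : 0 < D := by positivity
  have hB : 0 ≤ √(N * (1 + Real.log N)) := Real.sqrt_nonneg _
  -- For `N < |c|θ`, monotonicity gives `θ ψ(N/θ) ≤ θ ψ(|c|) ≤ 1`, and the trivial bound `N` is
  -- enough. Otherwise Dirichlet's theorem of order `2N` supplies a denominator `q ≥ (2/3) θ ψ(N/θ)`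
  -- for Weyl's inequality.
  rcases lt_or_ge (N : ℝ) (|(c : ℝ)| * θ) with hlt | hge
  · have hc : c ≠ 0 := by
      rintro rfl
      rw [Int.cast_zero, abs_zero, zero_mul] at hlt
      linarith
    have h1 : (minDen x (N / θ) : ℝ) ≤ minDen x |(c : ℝ)| := by
      exact_mod_cast minDen_mono x (by positivity) ((div_le_iff₀ hθ0).2 hlt.le)
    have h2 : D ≤ 1 := (mul_le_mul_of_nonneg_left h1 hθ0.le).trans (hmin hc)
    have h3 : (N : ℝ) ≤ N / √D := by
      rw [le_div_iff₀ (Real.sqrt_pos.2 hD0)]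
      have : √D ≤ 1 := Real.sqrt_le_one.2 h2
      nlinarith
    have := ThetaSeries.norm_weylSum_le y N
    linarith
  · obtain ⟨r, hr, hrN⟩ := Real.exists_rat_abs_sub_le_and_den_le y (n := 2 * N) (by omega)
    push_cast at hr
    have hq : (0 : ℝ) < r.den := by exact_mod_cast r.den_pos
    have h1 := norm_weylSum_sq_le_of_approx (by omega) hr hrN
    have h2 := happ hge (q := r.den) (p := r.num) (by exact_mod_cast r.den_pos) (by
      have e : ((r.den : ℤ) : ℝ) * y - r.num = r.den * (y - r) := by
        have : (r : ℝ) * r.den = r.num := by exact_mod_cast Rat.mul_den_eq_num r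
        rw [← this]; push_cast; ring
      rw [e, abs_mul, abs_of_pos hq]
      calc (r.den : ℝ) * |y - r| ≤ r.den * (1 / ((2 * N + 1) * r.den)) :=
            mul_le_mul_of_nonneg_left hr hq.le
        _ = 1 / (2 * N + 1) := by field_simp
        _ ≤ 1 / (2 * N) := one_div_le_one_div_of_le (by linarith) (by linarith))
    push_cast at h2
    have h3 : (N : ℝ) ^ 2 / r.den ≤ 3 / 2 * (N / √D) ^ 2 := by
      rw [div_pow, Real.sq_sqrt hD0.le, ← mul_div_assoc, div_le_div_iff₀ hq hD0]
      nlinarith [sq_nonneg (N : ℝ)]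
    have h4 : N * (1 + Real.log N) = √(N * (1 + Real.log N)) ^ 2 := by
      rw [Real.sq_sqrt]
      have := Real.log_nonneg hN'
      positivity
    have hA : 0 ≤ N / √D := by positivity
    refine abs_le_of_sq_le_sq' ?_ (by positivity) |>.2
    rw [h4] at h1
    nlinarith [mul_nonneg hA hB, sq_nonneg (√(N * (1 + Real.log N))), sq_nonneg (N / √D)]

/-! ### Summation by parts. -/

theorem partialF_eq_sum_range (s y : ℝ) (N : ℕ) :
    partialF s y N = ∑ k ∈ Finset.range N,
      Complex.exp (((Real.pi * ((k : ℝ) + 1) ^ 2 * y : ℝ) : ℂ) * Complex.I) *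
        ((((k + 1 : ℕ) : ℝ) ^ (-s) : ℝ) : ℂ) := by
  rw [partialF, sum_Icc_one_eq_sum_range]
  refine Finset.sum_congr rfl fun k _ => ?_
  rw [Real.rpow_neg (by positivity), Complex.ofReal_inv, ← div_eq_mul_inv]
  congr 2
  push_cast; ring

theorem partialF_by_parts (s y : ℝ) (N : ℕ) :
    partialF s y N = weylSum y N * ((((N + 1 : ℕ) : ℝ) ^ (-s) : ℝ) : ℂ) +
      ∑ k ∈ Finset.range N, weylSum y (k + 1) *
        ((((k + 1 : ℕ) : ℝ) ^ (-s) - ((k + 2 : ℕ) : ℝ) ^ (-s) : ℝ) : ℂ) := by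
  rw [partialF_eq_sum_range]
  induction N with
  | zero => simp [weylSum]
  | succ N ih =>
    rw [Finset.sum_range_succ, ih, Finset.sum_range_succ]
    have : weylSum y (N + 1) = weylSum y N +
      Complex.exp (((Real.pi * ((N : ℝ) + 1) ^ 2 * y : ℝ) : ℂ) * Complex.I) :=
      Finset.sum_range_succ _ _
    rw [this, Complex.ofReal_sub]
    ring

theorem rpow_neg_sub_le {s : ℝ} (hs1 : s ≤ 1) (k : ℕ) :
    ((k + 1 : ℕ) : ℝ) ^ (-s) - ((k + 2 : ℕ) : ℝ) ^ (-s) ≤ ((k + 1 : ℕ) : ℝ) ^ (-(s + 1)) := by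
  have hk : (0 : ℝ) < k + 1 := by positivity
  have hk2 : (0 : ℝ) < k + 2 := by positivity
  push_cast
  have h1 : ((k : ℝ) + 1) / (k + 2) ≤ (((k : ℝ) + 1) / (k + 2)) ^ s := by
    have := Real.rpow_le_rpow_of_exponent_ge (x := ((k : ℝ) + 1) / (k + 2)) (by positivity)
      ((div_le_one hk2).2 (by linarith)) hs1
    rwa [Real.rpow_one] at this
  have h2 : ((k : ℝ) + 2) ^ (-s) = ((k : ℝ) + 1) ^ (-s) * (((k : ℝ) + 1) / (k + 2)) ^ s := by
    rw [Real.div_rpow hk.le hk2.le, Real.rpow_neg hk.le, Real.rpow_neg hk2.le]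
    have := (Real.rpow_pos_of_pos hk s).ne'
    field_simp
  have h3 : ((k : ℝ) + 1) ^ (-(s + 1)) = ((k : ℝ) + 1) ^ (-s) * (1 / ((k : ℝ) + 1)) := by
    rw [neg_add, Real.rpow_add hk, Real.rpow_neg_one, one_div]
  rw [h2, h3, ← mul_one_sub]
  refine mul_le_mul_of_nonneg_left ?_ (by positivity)
  have h4 : 1 - ((k : ℝ) + 1) / (k + 2) = 1 / (k + 2) := by field_simp; ring
  have h5 : 1 / ((k : ℝ) + 2) ≤ 1 / (k + 1) := one_div_le_one_div_of_le hk (by linarith)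
  linarith

/-- Convergence of `F_s(y)` by summation by parts. -/
theorem exists_limit_partialF {s y G : ℝ} (hs : 0 < s) (hs1 : s ≤ 1) {g : ℕ → ℝ}
    (hg : ∀ k : ℕ, ‖weylSum y (k + 1)‖ * ((k + 1 : ℕ) : ℝ) ^ (-(s + 1)) ≤ g k)
    (hG : ∀ n : ℕ, ∑ k ∈ Finset.range n, g k ≤ G)
    (h0 : Tendsto (fun N : ℕ => ‖weylSum y N‖ * (N : ℝ) ^ (-s)) atTop (𝓝 0)) :
    ∃ F : ℂ, Tendsto (fun N => partialF s y N) atTop (𝓝 F) ∧ ‖F‖ ≤ G := by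
  have hg0 : ∀ k, 0 ≤ g k := fun k => le_trans (by positivity) (hg k)
  have hgs : Summable g := summable_of_sum_range_le hg0 hG
  have hbd : ∀ k : ℕ, ‖weylSum y (k + 1) *
        ((((k + 1 : ℕ) : ℝ) ^ (-s) - ((k + 2 : ℕ) : ℝ) ^ (-s) : ℝ) : ℂ)‖ ≤ g k := by
    intro k
    have h1 : ((k + 2 : ℕ) : ℝ) ^ (-s) ≤ ((k + 1 : ℕ) : ℝ) ^ (-s) := by
      refine Real.rpow_le_rpow_of_nonpos (by positivity) ?_ (by linarith)
      push_cast; linarith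
    rw [norm_mul, Complex.norm_real, Real.norm_of_nonneg (by linarith)]
    exact (mul_le_mul_of_nonneg_left (rpow_neg_sub_le hs1 k) (norm_nonneg _)).trans (hg k)
  have hsum := Summable.of_norm_bounded hgs hbd
  have hfirst : Tendsto (fun N : ℕ => weylSum y N * ((((N + 1 : ℕ) : ℝ) ^ (-s) : ℝ) : ℂ))
      atTop (𝓝 0) := by
    refine squeeze_zero_norm' ?_ h0
    filter_upwards [eventually_ge_atTop 1] with N hN
    have hN' : (0 : ℝ) < N := by exact_mod_cast hN
    rw [norm_mul, Complex.norm_real, Real.norm_of_nonneg (by positivity)]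
    refine mul_le_mul_of_nonneg_left ?_ (norm_nonneg _)
    refine Real.rpow_le_rpow_of_nonpos hN' ?_ (by linarith)
    push_cast; linarith
  have hlim := hfirst.add hsum.hasSum.tendsto_sum_nat
  refine ⟨_, hlim.congr fun N => (partialF_by_parts s y N).symm, ?_⟩
  rw [zero_add]
  exact (tsum_of_norm_bounded hgs.hasSum hbd).trans (hgs.tsum_le_of_sum_range_le hG)

/-! ### The diophantine integral and comparison of sums with it. -/

/-- The function `M^{-s} ψ(M)^{-1/2}`, where `ψ = minDen x`. -/
def dioph (s x M : ℝ) : ℝ := M ^ (-s) / √(minDen x M)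

theorem dioph_nonneg {s x M : ℝ} (hM : 0 < M) : 0 ≤ dioph s x M := by
  unfold dioph; positivity

theorem antitoneOn_dioph {s : ℝ} (hs : 0 < s) (x : ℝ) : AntitoneOn (dioph s x) (Ioi 0) := by
  intro M hM M' hM' h
  rw [mem_Ioi] at hM hM'
  have h1 : (1 : ℝ) ≤ minDen x M := by exact_mod_cast one_le_minDen x hM
  have h2 : (minDen x M : ℝ) ≤ minDen x M' := by exact_mod_cast minDen_mono x hM h
  unfold dioph
  refine div_le_div₀ (by positivity) (Real.rpow_le_rpow_of_nonpos hM h (by linarith))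
    (Real.sqrt_pos.2 (by linarith)) (Real.sqrt_le_sqrt h2)

theorem intervalIntegrable_dioph {s : ℝ} (hs : 0 < s) (x : ℝ) {a b : ℝ} (ha : 0 < a) (hb : 0 < b) :
    IntervalIntegrable (dioph s x) volume a b := by
  refine ((antitoneOn_dioph hs x).mono fun t ht => ?_).intervalIntegrable
  exact lt_of_lt_of_le (lt_min ha hb) ht.1

theorem sub_mul_dioph_le {s : ℝ} (hs : 0 < s) (x : ℝ) {a b : ℝ} (ha : 0 < a) (hab : a ≤ b) :
    (b - a) * dioph s x b ≤ ∫ t in a..b, dioph s x t := by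
  have h := intervalIntegral.integral_mono_on hab (f := fun _ => dioph s x b) (g := dioph s x)
    (by simp) (intervalIntegrable_dioph hs x ha (ha.trans_le hab))
    (fun t ht => antitoneOn_dioph hs x (lt_of_lt_of_le ha ht.1) (ha.trans_le hab) ht.2)
  rwa [intervalIntegral.integral_const, smul_eq_mul] at h

/-- The tail `∫_a^∞` of `dioph`. -/
def diophTail (s x a : ℝ) : ℝ := ∫ t in Ioi a, dioph s x t

theorem interval_le_diophTail {s x : ℝ} (hint : IntegrableOn (dioph s x) (Ioi (1 / 2)))
    {a b c : ℝ} (hc : 1 / 2 ≤ c) (hca : c ≤ a) (hab : a ≤ b) :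
    ∫ t in a..b, dioph s x t ≤ diophTail s x c := by
  rw [intervalIntegral.integral_of_le hab, diophTail]
  refine setIntegral_mono_set (hint.mono_set (Ioi_subset_Ioi hc)) ?_ ?_
  · refine (ae_restrict_iff' measurableSet_Ioi).2 (ae_of_all _ fun t ht => ?_)
    exact dioph_nonneg (lt_of_lt_of_le (by norm_num) (hc.trans (le_of_lt ht)))
  · exact LE.le.eventuallyLE fun t (ht : t ∈ Ioc a b) => lt_of_le_of_lt hca ht.1

theorem tendsto_diophTail {s x : ℝ} (hint : IntegrableOn (dioph s x) (Ioi (1 / 2))) :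
    Tendsto (diophTail s x) atTop (𝓝 0) := by
  have h1 := intervalIntegral_tendsto_integral_Ioi (1 / 2) hint tendsto_id
  have h2 := h1.const_sub (∫ t in Ioi (1 / 2), dioph s x t)
  rw [sub_self] at h2
  refine h2.congr' ?_
  filter_upwards [eventually_ge_atTop (1 / 2)] with a ha
  rw [id, intervalIntegral.integral_of_le ha, diophTail, sub_eq_iff_eq_add, add_comm,
    ← setIntegral_union (Ioc_disjoint_Ioi le_rfl) measurableSet_Ioi
      (hint.mono_set Ioc_subset_Ioi_self) (hint.mono_set (Ioi_subset_Ioi ha)),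
    Ioc_union_Ioi_eq_Ioi ha]

/-- As `dioph` decreases, its value at `t` is at most its mean over `[t/2, t]`. The condition `t ≥
1` is what makes `1/2` the natural lower end of the integral. -/
theorem mul_dioph_le {s x : ℝ} (hs : 0 < s) (hint : IntegrableOn (dioph s x) (Ioi (1 / 2)))
    {t : ℝ} (ht : 1 ≤ t) : t * dioph s x t ≤ 2 * diophTail s x (t / 2) := by
  have h1 := sub_mul_dioph_le hs x (a := t / 2) (b := t) (by linarith) (by linarith)
  have h2 := interval_le_diophTail hint (a := t / 2) (b := t) (c := t / 2) (by linarith) le_rfl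
    (by linarith)
  linarith

/-- A Riemann sum of step `t` for a decreasing function. The terms from the second on are bounded by
the integral from `t`; the first has no full interval of length `t` inside the allowed range and
costs twice the tail from `t/2`. -/
theorem sum_dioph_le {s x : ℝ} (hs : 0 < s) (hint : IntegrableOn (dioph s x) (Ioi (1 / 2)))
    {t : ℝ} (ht : 1 ≤ t) (n : ℕ) :
    ∑ k ∈ Finset.range n, t * dioph s x (((k + 1 : ℕ) : ℝ) * t) ≤ 3 * diophTail s x (t / 2) := by
  have ht0 : 0 < t := by linarith
  have hsteps : ∀ n : ℕ, ∑ k ∈ Finset.range n, t * dioph s x (((k + 2 : ℕ) : ℝ) * t) ≤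
      ∫ v in t..((n + 1 : ℕ) : ℝ) * t, dioph s x v := by
    intro n
    induction n with
    | zero => simp
    | succ n ih =>
      rw [Finset.sum_range_succ, ← intervalIntegral.integral_add_adjacent_intervals
        (intervalIntegrable_dioph hs x ht0 (b := ((n + 1 : ℕ) : ℝ) * t) (by positivity))
        (intervalIntegrable_dioph hs x (a := ((n + 1 : ℕ) : ℝ) * t) (by positivity) (by positivity))]
      refine add_le_add ih ?_
      have := sub_mul_dioph_le hs x (a := ((n + 1 : ℕ) : ℝ) * t) (b := ((n + 1 + 1 : ℕ) : ℝ) * t)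
        (by positivity) (by gcongr; omega)
      refine le_trans (le_of_eq ?_) this
      push_cast; ring_nf
  have hT0 : 0 ≤ diophTail s x (t / 2) := by
    have := mul_dioph_le hs hint ht
    have := mul_nonneg ht0.le (dioph_nonneg (s := s) (x := x) ht0)
    linarith
  cases n with
  | zero => simpa using by positivity
  | succ n =>
    rw [Finset.sum_range_succ']
    have h1 := mul_dioph_le hs hint ht
    have h2 := (hsteps n).trans (interval_le_diophTail hint (c := t / 2) (by linarith) (by linarith)
      (by push_cast; nlinarith [mul_nonneg (Nat.cast_nonneg (α := ℝ) n) ht0.le]))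
    simp only [zero_add, Nat.cast_one, one_mul]
    simp only [show ∀ k : ℕ, k + 1 + 1 = k + 2 from fun k => rfl]
    linarith

/-- The logarithm is absorbed by half of the surplus `s - 1/2`, which leaves the exponent `s/2 + 3/4
> 1` in the sum below. -/
theorem sqrt_one_add_log_le {s : ℝ} (hs : 1 / 2 < s) {N : ℕ} (hN : 1 ≤ N) :
    √(1 + Real.log N) ≤ √(1 + 1 / (s - 1 / 2)) * (N : ℝ) ^ ((s - 1 / 2) / 2) := by
  have hN' : (1 : ℝ) ≤ N := by exact_mod_cast hN
  have hδ : 0 < s - 1 / 2 := by linarith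
  have h1 := Real.log_le_rpow_div (x := N) (by linarith) hδ
  have h2 : (1 : ℝ) ≤ (N : ℝ) ^ (s - 1 / 2) := Real.one_le_rpow hN' hδ.le
  have h3 : 1 + Real.log N ≤ (1 + 1 / (s - 1 / 2)) * (N : ℝ) ^ (s - 1 / 2) := by
    have : (1 + 1 / (s - 1 / 2)) * (N : ℝ) ^ (s - 1 / 2) =
      (N : ℝ) ^ (s - 1 / 2) + (N : ℝ) ^ (s - 1 / 2) / (s - 1 / 2) := by ring
    linarith
  refine (Real.sqrt_le_sqrt h3).trans (le_of_eq ?_)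
  rw [Real.sqrt_mul (by positivity), Real.sqrt_eq_rpow ((N : ℝ) ^ (s - 1 / 2)),
    ← Real.rpow_mul (by linarith)]
  congr 2; ring

theorem exists_sum_log_le {s : ℝ} (hs : 1 / 2 < s) : ∃ C : ℝ, 0 ≤ C ∧ ∀ n : ℕ,
    ∑ k ∈ Finset.range n, √(1 + Real.log (k + 1 : ℕ)) * ((k + 1 : ℕ) : ℝ) ^ (-(s + 1 / 2)) ≤ C := by
  set A := √(1 + 1 / (s - 1 / 2)) with hA
  have hbd : ∀ k : ℕ, √(1 + Real.log (k + 1 : ℕ)) * ((k + 1 : ℕ) : ℝ) ^ (-(s + 1 / 2)) ≤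
      A * (1 / ((k + 1 : ℕ) : ℝ) ^ (s / 2 + 3 / 4)) := by
    intro k
    have hk : (0 : ℝ) < (k + 1 : ℕ) := by positivity
    refine (mul_le_mul_of_nonneg_right (sqrt_one_add_log_le hs (Nat.succ_pos k))
      (by positivity)).trans (le_of_eq ?_)
    rw [← hA, mul_assoc, ← Real.rpow_add hk, one_div (((k + 1 : ℕ) : ℝ) ^ (s / 2 + 3 / 4)), ← Real.rpow_neg hk.le]
    congr 2; ring
  have hsum : Summable fun k : ℕ => A * (1 / ((k + 1 : ℕ) : ℝ) ^ (s / 2 + 3 / 4)) :=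
    ((summable_nat_add_iff 1).2 (Real.summable_one_div_nat_rpow.2 (by linarith))).mul_left A
  refine ⟨∑' k : ℕ, A * (1 / ((k + 1 : ℕ) : ℝ) ^ (s / 2 + 3 / 4)),
    tsum_nonneg fun k => by positivity, fun n => ?_⟩
  exact (Finset.sum_le_sum fun k _ => hbd k).trans
    (hsum.sum_le_tsum _ fun k _ => by positivity)

theorem tendsto_log_term {s : ℝ} (hs : 1 / 2 < s) :
    Tendsto (fun N : ℕ => √(N * (1 + Real.log N)) * (N : ℝ) ^ (-s)) atTop (𝓝 0) := by
  have h1 : Tendsto (fun N : ℕ => √(1 + 1 / (s - 1 / 2)) * (N : ℝ) ^ (-((s - 1 / 2) / 2)))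
      atTop (𝓝 0) := by
    have := ((tendsto_rpow_neg_atTop (y := (s - 1 / 2) / 2) (by linarith)).comp
      tendsto_natCast_atTop_atTop).const_mul (√(1 + 1 / (s - 1 / 2)))
    rw [mul_zero] at this
    exact this
  refine squeeze_zero' (Eventually.of_forall fun N => by positivity) ?_ h1
  filter_upwards [eventually_ge_atTop 1] with N hN
  have hN' : (0 : ℝ) < N := by exact_mod_cast hN
  have h2 := sqrt_one_add_log_le hs hN
  rw [Real.sqrt_mul hN'.le]
  calc √(N : ℝ) * √(1 + Real.log N) * (N : ℝ) ^ (-s)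
      ≤ √(N : ℝ) * (√(1 + 1 / (s - 1 / 2)) * (N : ℝ) ^ ((s - 1 / 2) / 2)) * (N : ℝ) ^ (-s) := by
        gcongr
    _ = √(1 + 1 / (s - 1 / 2)) * ((N : ℝ) ^ (1 / 2 : ℝ) * (N : ℝ) ^ ((s - 1 / 2) / 2) *
          (N : ℝ) ^ (-s)) := by rw [Real.sqrt_eq_rpow (N : ℝ)]; ring
    _ = _ := by
        rw [← Real.rpow_add hN', ← Real.rpow_add hN']
        congr 2; ring

theorem IsOrbit.pos {x y : ℝ} {a b c d : ℤ} (h : IsOrbit x y a b c d) :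
    0 < |(a : ℝ) - c * x| := by
  rcases (abs_nonneg ((a : ℝ) - c * x)).eq_or_lt with h0 | h0
  · have := h.mul_eq_one
    rw [← h0, zero_mul] at this
    norm_num at this
  · exact h0

/-- The substitution `M = N/θ`: the sum over `N` becomes a Riemann sum of step `1/θ` for `dioph`.
The factor `θ^{1/2-s}` that comes out is cancelled by the weight `θ^{s-1/2}` of the iterated
functional equation. -/
theorem rpow_div_sqrt_eq {s x θ : ℝ} (hθ : 0 < θ) {N : ℕ} (hN : 1 ≤ N) :
    (N : ℝ) ^ (-s) / √(θ * minDen x (N / θ)) =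
      θ ^ (1 / 2 - s) * (1 / θ * dioph s x (N * (1 / θ))) := by
  have hN' : (0 : ℝ) < N := by exact_mod_cast hN
  rw [mul_one_div, dioph, Real.sqrt_mul hθ.le, Real.div_rpow hN'.le hθ.le, Real.rpow_sub hθ,
    Real.rpow_neg hθ.le s, Real.sqrt_eq_rpow θ]
  have h1 : θ = θ ^ (1 / 2 : ℝ) * θ ^ (1 / 2 : ℝ) := by
    rw [← Real.rpow_add hθ]; norm_num
  have h2 := Real.rpow_pos_of_pos hθ (1 / 2 : ℝ)
  have h3 := Real.rpow_pos_of_pos hθ s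
  have h4 : (0 : ℝ) < √(minDen x (N / θ)) := by
    refine Real.sqrt_pos.2 ?_
    exact_mod_cast one_le_minDen x (by positivity : (0 : ℝ) < N / θ)
  set w := θ ^ (1 / 2 : ℝ) with hw
  have h5 : 1 / θ = 1 / (w * w) := by rw [← h1]
  rw [h5]
  field_simp

/-- Convergence of `F_s` along the orbit of `x`, with a bound. -/
theorem IsOrbit.exists_limit {s x y : ℝ} {a b c d : ℤ} (h : IsOrbit x y a b c d) (hs : 1 / 2 < s)
    (hs1 : s ≤ 1) (hint : IntegrableOn (dioph s x) (Ioi (1 / 2))) (hθ1 : |(a : ℝ) - c * x| ≤ 1)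
    {C : ℝ} (hC : ∀ n : ℕ, ∑ k ∈ Finset.range n, √(1 + Real.log (k + 1 : ℕ)) *
      ((k + 1 : ℕ) : ℝ) ^ (-(s + 1 / 2)) ≤ C) :
    ∃ F : ℂ, Tendsto (fun N => partialF s y N) atTop (𝓝 F) ∧
      |(a : ℝ) - c * x| ^ (s - 1 / 2) * ‖F‖ ≤ 8 * (3 * diophTail s x (1 / |(a : ℝ) - c * x| / 2) +
        |(a : ℝ) - c * x| ^ (s - 1 / 2) * C) := by
  have hθ0 := h.pos
  have hW := fun {N : ℕ} (hN : 1 ≤ N) => h.norm_weylSum_le hN hθ1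
  set θ := |(a : ℝ) - c * x| with hθ
  have ht : 1 ≤ 1 / θ := (one_le_div hθ0).2 hθ1
  have hex : ∃ F : ℂ, Tendsto (fun N => partialF s y N) atTop (𝓝 F) ∧
      ‖F‖ ≤ 8 * (θ ^ (1 / 2 - s) * (3 * diophTail s x (1 / θ / 2)) + C) := by
    refine exists_limit_partialF (g := fun k => 8 * (θ ^ (1 / 2 - s) *
      (1 / θ * dioph s x (((k + 1 : ℕ) : ℝ) * (1 / θ))) + √(1 + Real.log (k + 1 : ℕ)) *
      ((k + 1 : ℕ) : ℝ) ^ (-(s + 1 / 2)))) (by linarith) hs1 ?_ ?_ ?_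
    · intro k
      have hk : (0 : ℝ) < (k + 1 : ℕ) := by positivity
      rw [← rpow_div_sqrt_eq hθ0 (Nat.succ_pos k)]
      refine (mul_le_mul_of_nonneg_right (hW (Nat.succ_pos k)) (by positivity)).trans (le_of_eq ?_)
      have e1 : ((k + 1 : ℕ) : ℝ) ^ (-s) = ((k + 1 : ℕ) : ℝ) * ((k + 1 : ℕ) : ℝ) ^ (-(s + 1)) := by
        nth_rewrite 2 [← Real.rpow_one ((k + 1 : ℕ) : ℝ)]
        rw [← Real.rpow_add hk]; congr 1; ring
      have e2 : ((k + 1 : ℕ) : ℝ) ^ (-(s + 1 / 2)) =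
          √((k + 1 : ℕ) : ℝ) * ((k + 1 : ℕ) : ℝ) ^ (-(s + 1)) := by
        rw [Real.sqrt_eq_rpow, ← Real.rpow_add hk]; congr 1; ring
      rw [e1, e2, Real.sqrt_mul hk.le]
      ring
    · intro n
      rw [← Finset.mul_sum, Finset.sum_add_distrib, ← Finset.mul_sum]
      have h1 := sum_dioph_le (by linarith) hint ht n
      have h2 := hC n
      have h3 := Real.rpow_pos_of_pos hθ0 (1 / 2 - s)
      gcongr
    · have h1 : Tendsto (fun N : ℕ => 8 * (θ ^ (1 / 2 - s) * (2 * diophTail s x (N * (1 / θ) / 2)) +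
          √(N * (1 + Real.log N)) * (N : ℝ) ^ (-s))) atTop (𝓝 0) := by
        have h2 : Tendsto (fun N : ℕ => (N : ℝ) * (1 / θ) / 2) atTop atTop :=
          (tendsto_natCast_atTop_atTop.atTop_mul_const (by positivity)).atTop_div_const (by norm_num)
        have h3 := ((((tendsto_diophTail hint).comp h2).const_mul 2).const_mul
          (θ ^ (1 / 2 - s))) |>.add (tendsto_log_term hs) |>.const_mul 8
        simpa using h3
      refine squeeze_zero' (Eventually.of_forall fun N => by positivity) ?_ h1
      filter_upwards [eventually_ge_atTop 1] with N hN
      have hN' : (1 : ℝ) ≤ N := by exact_mod_cast hN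
      refine (mul_le_mul_of_nonneg_right (hW hN) (by positivity)).trans ?_
      have h4 : (N : ℝ) / √(θ * minDen x (N / θ)) * (N : ℝ) ^ (-s) =
          θ ^ (1 / 2 - s) * (N * (1 / θ) * dioph s x (N * (1 / θ))) := by
        have := rpow_div_sqrt_eq (s := s) (x := x) hθ0 hN
        rw [div_mul_eq_mul_div, mul_div_assoc, this]; ring
      have h5 := mul_dioph_le (s := s) (x := x) (by linarith) hint (t := N * (1 / θ)) (by nlinarith)
      have h6 := mul_le_mul_of_nonneg_left h5 (Real.rpow_pos_of_pos hθ0 (1 / 2 - s)).le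
      rw [← h4] at h6
      linarith
  obtain ⟨F, hF, hFG⟩ := hex
  refine ⟨F, hF, ?_⟩
  have h1 := mul_le_mul_of_nonneg_left hFG (Real.rpow_pos_of_pos hθ0 (s - 1 / 2)).le
  refine h1.trans (le_of_eq ?_)
  have h2 : θ ^ (s - 1 / 2) * θ ^ (1 / 2 - s) = 1 := by
    rw [← Real.rpow_add hθ0]; simp
  linear_combination 24 * diophTail s x (1 / θ / 2) * h2

/-! ### Iterating the functional equation. -/

theorem absProd_le_one {x : ℝ} (hx : Irrational x) (hx1 : |x| < 1) (J : ℕ) :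
    absProd x J ≤ 1 := by
  have h : ∀ J : ℕ, |T^[J] x| ≤ 1 := by
    intro J
    obtain ⟨_, _, _, _, h, -⟩ := exists_isOrbit hx hx1 J
    exact h.abs_lt_one.le
  rw [absProd, Finset.abs_prod]
  exact Finset.prod_le_one (fun _ _ => abs_nonneg _) fun l _ => h l

/-- The product is `θ = |a - cx| ≤ 1/ψ(|c|)` with `|c| ≥ J`. Thus it is at most `1/ψ(J)`, although
single factors may be close to `1`. -/
theorem tendsto_absProd {x : ℝ} (hx : Irrational x) (hx1 : |x| < 1)
    (hψ : Tendsto (fun J : ℕ => (minDen x J : ℝ)) atTop atTop) :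
    Tendsto (absProd x) atTop (𝓝 0) := by
  refine squeeze_zero' (Eventually.of_forall fun J => abs_nonneg _) ?_ hψ.inv_tendsto_atTop
  filter_upwards [eventually_ge_atTop 1] with J hJ
  obtain ⟨a, b, c, d, h, hc, hp⟩ := exists_isOrbit hx hx1 J
  have hc0 : c ≠ 0 := by
    rintro rfl
    rw [abs_zero] at hc; omega
  have h1 := h.minDen_mul_le_one hc0
  have hJ' : (0 : ℝ) < J := by exact_mod_cast hJ
  have h2 : (minDen x J : ℝ) ≤ minDen x |(c : ℝ)| := by
    exact_mod_cast minDen_mono x hJ' (by exact_mod_cast hc)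
  have h3 : (0 : ℝ) < minDen x J := by exact_mod_cast one_le_minDen x hJ'
  rw [hp, Pi.inv_apply, ← one_div, le_div_iff₀ h3]
  exact (mul_le_mul_of_nonneg_left h2 (abs_nonneg _)).trans h1

theorem norm_phase (x : ℝ) (J : ℕ) : ‖phase x J‖ = 1 := by
  rw [phase, Complex.norm_exp]
  simp

/-- The iterated functional equation. -/
theorem FEqualsSeries_of_integrable {s x : ℝ} (hs : 1 / 2 < s) (hs1 : s ≤ 1) (hx : Irrational x)
    (hx1 : |x| < 1) (hint : IntegrableOn (dioph s x) (Ioi (1 / 2)))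
    (hψ : Tendsto (fun J : ℕ => (minDen x J : ℝ)) atTop atTop) :
    FEqualsSeries s x (fun j : ℕ => phase x j * ((absProd x j ^ (s - 1 / 2) : ℝ) : ℂ) *
      Omega s (T^[j] x)) := by
  obtain ⟨C, hC0, hC⟩ := exists_sum_log_le hs
  have hex : ∀ J : ℕ, ∃ F : ℂ, Tendsto (fun N => partialF s (T^[J] x) N) atTop (𝓝 F) ∧
      absProd x J ^ (s - 1 / 2) * ‖F‖ ≤ 8 * (3 * diophTail s x (1 / absProd x J / 2) +
        absProd x J ^ (s - 1 / 2) * C) := by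
    intro J
    obtain ⟨a, b, c, d, h, -, hp⟩ := exists_isOrbit hx hx1 J
    rw [hp]
    exact h.exists_limit hs hs1 hint (hp ▸ absProd_le_one hx hx1 J) hC
  choose F hF hFb using hex
  have hirr : ∀ J : ℕ, Irrational (T^[J] x) := by
    intro J
    obtain ⟨_, _, _, _, h, -⟩ := exists_isOrbit hx hx1 J
    exact h.irr
  have hpos : ∀ J : ℕ, 0 < absProd x J := by
    intro J
    obtain ⟨_, _, _, _, h, -, hp⟩ := exists_isOrbit hx hx1 J
    rw [hp]; exact h.pos
  -- Convergence at each orbit point is already known from Weyl's inequality, so the functional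
  -- equation becomes an identity between limits.
  have hstep : ∀ J : ℕ, F J = Complex.exp (Complex.I * (Real.pi / 4) *
      ((Real.sign (T^[J] x) : ℝ) : ℂ)) * ((|T^[J] x| ^ (s - 1 / 2) : ℝ) : ℂ) * F (J + 1) +
      Omega s (T^[J] x) := by
    intro J
    refine tendsto_nhds_unique (hF J) (tendsto_partialF (by linarith) (hirr J).ne_zero ?_)
    have := hF (J + 1)
    rw [Function.iterate_succ_apply'] at this
    simpa only [partialF_T] using this
  have hiter : ∀ J : ℕ, F 0 = (∑ j ∈ Finset.range J, phase x j *
      ((absProd x j ^ (s - 1 / 2) : ℝ) : ℂ) * Omega s (T^[j] x)) +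
      phase x J * ((absProd x J ^ (s - 1 / 2) : ℝ) : ℂ) * F J := by
    intro J
    induction J with
    | zero => simp [phase, absProd]
    | succ J ih =>
      have e1 : phase x (J + 1) = phase x J * Complex.exp (Complex.I * (Real.pi / 4) *
          ((Real.sign (T^[J] x) : ℝ) : ℂ)) := by
        rw [phase, phase, ← Complex.exp_add, Finset.sum_range_succ]
        push_cast; ring_nf
      have e2 : absProd x (J + 1) ^ (s - 1 / 2) =
          absProd x J ^ (s - 1 / 2) * |T^[J] x| ^ (s - 1 / 2) := by
        rw [absProd, absProd, Finset.prod_range_succ, abs_mul,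
          Real.mul_rpow (abs_nonneg _) (abs_nonneg _)]
      rw [Finset.sum_range_succ, ih, e1, e2, hstep J]
      push_cast; ring
  have hθ := tendsto_absProd hx hx1 hψ
  -- The bound consists of the tail of a convergent integral from `1/(2θ) → ∞` and of a power
  -- `θ^{s-1/2} → 0`.
  have hrem : Tendsto (fun J => phase x J * ((absProd x J ^ (s - 1 / 2) : ℝ) : ℂ) * F J)
      atTop (𝓝 0) := by
    have hinv : Tendsto (fun J => 1 / absProd x J / 2) atTop atTop := by
      have : Tendsto (absProd x) atTop (𝓝[>] 0) :=
        tendsto_nhdsWithin_iff.2 ⟨hθ, Eventually.of_forall hpos⟩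
      simp only [one_div]
      exact this.inv_tendsto_nhdsGT_zero.atTop_div_const (by norm_num : (0 : ℝ) < 2)
    have hpow : Tendsto (fun J => absProd x J ^ (s - 1 / 2)) atTop (𝓝 0) := by
      have := hθ.rpow_const (p := s - 1 / 2) (Or.inr (by linarith))
      rwa [Real.zero_rpow (by linarith)] at this
    have hlim := ((((tendsto_diophTail hint).comp hinv).const_mul 3).add
      (hpow.mul_const C)).const_mul 8
    rw [mul_zero, zero_mul, add_zero, mul_zero] at hlim
    refine squeeze_zero_norm (fun J => ?_) hlim
    rw [norm_mul, norm_mul, norm_phase, one_mul, Complex.norm_real,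
      Real.norm_of_nonneg (Real.rpow_nonneg (hpos J).le _)]
    exact hFb J
  refine ⟨F 0, hF 0, ?_⟩
  have := hrem.const_sub (F 0)
  rw [sub_zero] at this
  refine this.congr fun J => ?_
  rw [hiter J]; ring

/-! ### Convergent denominators of the regular continued fraction. -/

theorem not_terminatedAt {x : ℝ} (hx : Irrational x) (n : ℕ) :
    ¬(GenContFract.of x).TerminatedAt n := by
  intro h
  obtain ⟨q, hq⟩ := (GenContFract.terminates_iff_rat x).1 ⟨n, h⟩
  exact hx ⟨q, hq.symm⟩

theorem exists_int_contsAux {x : ℝ} (hx : Irrational x) (n : ℕ) :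
    (∃ p q : ℤ, (GenContFract.of x).contsAux n = ⟨p, q⟩) ∧
      ∃ p q : ℤ, (GenContFract.of x).contsAux (n + 1) = ⟨p, q⟩ := by
  induction n with
  | zero =>
    refine ⟨⟨1, 0, by simp [GenContFract.contsAux]⟩, ⟨⌊x⌋, 1, ?_⟩⟩
    simp [GenContFract.contsAux, GenContFract.of_h_eq_floor]
  | succ n ih =>
    refine ⟨ih.2, ?_⟩
    obtain ⟨⟨p, q, h1⟩, ⟨p', q', h2⟩⟩ := ih
    obtain ⟨gp, hgp⟩ : ∃ gp, (GenContFract.of x).s.get? n = some gp :=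
      Option.ne_none_iff_exists'.1 (not_terminatedAt hx n)
    obtain ⟨ha, z, hz⟩ := GenContFract.of_partNum_eq_one_and_exists_int_partDen_eq hgp
    refine ⟨z * p' + p, z * q' + q, ?_⟩
    rw [GenContFract.contsAux_recurrence hgp h1 h2, ha, hz]
    push_cast
    simp

theorem exists_int_num_den {x : ℝ} (hx : Irrational x) (n : ℕ) :
    ∃ p q : ℤ, (GenContFract.of x).nums n = p ∧ Q x n = q := by
  obtain ⟨p, q, h⟩ := (exists_int_contsAux hx n).2
  refine ⟨p, q, ?_, ?_⟩
  · rw [GenContFract.num_eq_conts_a, GenContFract.nth_cont_eq_succ_nth_contAux, h]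
  · rw [Q, GenContFract.den_eq_conts_b, GenContFract.nth_cont_eq_succ_nth_contAux, h]

theorem fib_le_Q {x : ℝ} (hx : Irrational x) (n : ℕ) : (Nat.fib (n + 1) : ℝ) ≤ Q x n :=
  GenContFract.succ_nth_fib_le_of_nth_den (Or.inr (not_terminatedAt hx _))

theorem one_le_Q {x : ℝ} (hx : Irrational x) (n : ℕ) : 1 ≤ Q x n := by
  refine le_trans ?_ (fib_le_Q hx n)
  exact_mod_cast Nat.fib_pos.2 (Nat.succ_pos n)

theorem Q_mono (x : ℝ) : Monotone (Q x) :=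
  monotone_nat_of_le_succ fun _ => GenContFract.of_den_mono

/-- Fibonacci numbers at least double every two steps; the constant `2` covers both starting values.
-/
theorem sqrt_two_pow_le_fib (n : ℕ) : √2 ^ n ≤ 2 * (Nat.fib (n + 1) : ℝ) := by
  have h2 : √2 ^ 2 = (2 : ℝ) := Real.sq_sqrt (by norm_num)
  induction n using Nat.twoStepInduction with
  | zero => simp
  | one => simp
  | more n ih _ =>
    have h3 : 2 * Nat.fib (n + 1) ≤ Nat.fib (n + 2 + 1) := by
      have e : Nat.fib (n + 2 + 1) = Nat.fib (n + 1) + Nat.fib (n + 2) := Nat.fib_add_two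
      have : Nat.fib (n + 1) ≤ Nat.fib (n + 2) := Nat.fib_le_fib_succ
      omega
    have h4 : 2 * (Nat.fib (n + 1) : ℝ) ≤ Nat.fib (n + 2 + 1) := by exact_mod_cast h3
    rw [pow_add, h2]
    linarith

theorem sqrt_two_pow_le_Q {x : ℝ} (hx : Irrational x) (n : ℕ) : √2 ^ n / 2 ≤ Q x n := by
  have := sqrt_two_pow_le_fib n
  linarith [fib_le_Q hx n]

theorem tendsto_Q {x : ℝ} (hx : Irrational x) : Tendsto (Q x) atTop atTop := by
  refine tendsto_atTop_mono (sqrt_two_pow_le_Q hx) ?_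
  exact (tendsto_pow_atTop_atTop_of_one_lt Real.one_lt_sqrt_two).atTop_div_const (by norm_num)

theorem summable_Q_rpow {x : ℝ} (hx : Irrational x) {η : ℝ} (hη : 0 < η) :
    Summable fun n => Q x n ^ (-η) := by
  have h1 : (√2 : ℝ) ^ (-η) < 1 := Real.rpow_lt_one_of_one_lt_of_neg Real.one_lt_sqrt_two (by linarith)
  refine Summable.of_nonneg_of_le (fun n => Real.rpow_nonneg (by linarith [one_le_Q hx n]) _)
    (fun n => ?_) ((summable_geometric_of_lt_one (by positivity) h1).mul_left ((1 / 2 : ℝ) ^ (-η)))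
  have h2 : (0 : ℝ) < √2 ^ n / 2 := by positivity
  refine (Real.rpow_le_rpow_of_nonpos h2 (sqrt_two_pow_le_Q hx n) (by linarith)).trans (le_of_eq ?_)
  rw [show √2 ^ n / 2 = 1 / 2 * √2 ^ n by ring, Real.mul_rpow (by norm_num) (by positivity),
    ← Real.rpow_natCast, ← Real.rpow_natCast, ← Real.rpow_mul (by positivity),
    ← Real.rpow_mul (by positivity), mul_comm (n : ℝ)]

theorem abs_Q_mul_sub_le {x : ℝ} (hx : Irrational x) (n : ℕ) :
    |x - (GenContFract.of x).nums n / Q x n| ≤ 1 / (Q x n * Q x (n + 1)) :=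
  GenContFract.abs_sub_convs_le (not_terminatedAt hx n)

/-- Let `p/q` be an approximation with `q < Q_n`. It differs from the `n`-th convergent, so the
integer determinant of the two fractions is nonzero. This gives `1 ≤ q/Q_{n+1} + Q_n/M ≤ q/Q_{n+1} +
1/2`, hence `q ≥ Q_{n+1}/2`. -/
theorem half_Q_le_minDen {x : ℝ} (hx : Irrational x) (n : ℕ) {M : ℝ} (hM : 2 * Q x n ≤ M) :
    Q x n / 2 ≤ minDen x M := by
  have hQ1 := one_le_Q hx n
  have hQ2 := one_le_Q hx (n + 1)
  have hmono : Q x n ≤ Q x (n + 1) := Q_mono x (Nat.le_succ n)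
  have hM0 : 0 < M := by linarith
  obtain ⟨p, hp⟩ := exists_minDen x hM0
  have hq1 := one_le_minDen x hM0
  set q := minDen x M with hq
  rcases le_or_gt (Q x n) q with h | h
  · linarith
  obtain ⟨P, R, hP, hR⟩ := exists_int_num_den hx n
  obtain ⟨P', R', hP', hR'⟩ := exists_int_num_den hx (n + 1)
  have hdet : P * R' - R * P' = (-1) ^ (n + 1) := by
    have := SimpContFract.determinant (s := SimpContFract.of x) (n := n) (not_terminatedAt hx n)
    change (GenContFract.of x).nums n * Q x (n + 1) - Q x n * (GenContFract.of x).nums (n + 1) = _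
      at this
    rw [hP, hR, hP', hR'] at this
    exact_mod_cast this
  have happ : |Q x n * x - P| ≤ 1 / Q x (n + 1) := by
    have h1 := abs_Q_mul_sub_le hx n
    rw [hP] at h1
    have h2 : Q x n * x - P = Q x n * (x - P / Q x n) := by field_simp
    rw [h2, abs_mul, abs_of_pos (by linarith)]
    refine (mul_le_mul_of_nonneg_left h1 (by linarith)).trans (le_of_eq ?_)
    field_simp
  -- The determinant identity for consecutive convergents makes `P` and `R` coprime, so a vanishing
  -- determinant would force `R` to divide `q`, against `q < R`.
  have hD : p * R - q * P ≠ 0 := by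
    intro h0
    have hcop : IsCoprime R P := by
      rcases neg_one_pow_eq_or ℤ (n + 1) with e | e
      · exact ⟨-P', R', by rw [e] at hdet; linear_combination hdet⟩
      · exact ⟨P', -R', by rw [e] at hdet; linear_combination -hdet⟩
    have h1 : R ∣ (q : ℤ) * P := ⟨p, by linear_combination -h0⟩
    have h2 := Int.le_of_dvd (by exact_mod_cast hq1) (hcop.dvd_of_dvd_mul_right h1)
    have h3 : (R : ℝ) ≤ q := by exact_mod_cast h2
    rw [hR] at h
    linarith
  have h1 : (1 : ℝ) ≤ |(p : ℝ) * R - q * P| := by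
    have := Int.one_le_abs hD
    exact_mod_cast this
  have h2 : (p : ℝ) * R - q * P = q * (Q x n * x - P) - Q x n * (q * x - p) := by
    rw [hR]; ring
  rw [h2] at h1
  have h3 := abs_sub ((q : ℝ) * (Q x n * x - P)) (Q x n * (q * x - p))
  rw [abs_mul, abs_mul, abs_of_nonneg (Nat.cast_nonneg q : (0 : ℝ) ≤ q), abs_of_pos (by linarith : 0 < Q x n)] at h3
  have h4 : (q : ℝ) * |Q x n * x - P| ≤ q / Q x (n + 1) := by
    rw [← mul_one_div]; exact mul_le_mul_of_nonneg_left happ (Nat.cast_nonneg q)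
  have h5 : Q x n * |q * x - p| ≤ 1 / 2 := by
    refine (mul_le_mul_of_nonneg_left hp (by linarith)).trans ?_
    rw [mul_one_div, div_le_div_iff₀ hM0 (by norm_num)]; linarith
  have h6 : 1 / 2 ≤ (q : ℝ) / Q x (n + 1) := by linarith
  rw [le_div_iff₀ (by linarith)] at h6
  linarith

theorem tendsto_minDen {x : ℝ} (hx : Irrational x) :
    Tendsto (fun J : ℕ => (minDen x J : ℝ)) atTop atTop := by
  refine tendsto_atTop.2 fun K => ?_
  obtain ⟨n, hn⟩ := ((tendsto_Q hx).eventually_ge_atTop (2 * K)).exists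
  filter_upwards [tendsto_natCast_atTop_atTop.eventually_ge_atTop (2 * Q x n)] with J hJ
  have := half_Q_le_minDen hx n hJ
  linarith

/-! ### Series (1) and (2) imply convergence of the diophantine integral. -/

/-- The half-line is cut at the points `2Q_n`. On each piece `ψ` is at least half of the left
denominator and leaves the integral, which is why only `∫ t^{-s}` has to be bounded by `c`. -/
theorem integrableOn_dioph {s x : ℝ} (hs : 0 < s) (hx : Irrational x) {c : ℕ → ℝ}
    (hc : ∀ m, ∫ t in (2 * Q x (m + 1))..(2 * Q x (m + 2)), t ^ (-s) ≤ c m)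
    (hsum : Summable fun m => c m / √(Q x (m + 1))) :
    IntegrableOn (dioph s x) (Ioi (1 / 2)) := by
  have hQ := one_le_Q hx
  have hpiece : ∀ m, ∫ t in (2 * Q x (m + 1))..(2 * Q x (m + 2)), dioph s x t ≤
      √2 * (c m / √(Q x (m + 1))) := by
    intro m
    have h0 := hQ (m + 1)
    have h1 : Q x (m + 1) ≤ Q x (m + 2) := Q_mono x (Nat.le_succ _)
    have hcont : IntervalIntegrable (fun t : ℝ => t ^ (-s)) volume (2 * Q x (m + 1))
        (2 * Q x (m + 2)) := by
      refine intervalIntegral.intervalIntegrable_rpow (Or.inr ?_)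
      rw [uIcc_of_le (by linarith)]
      rintro ⟨h, -⟩; linarith
    have h2 : ∫ t in (2 * Q x (m + 1))..(2 * Q x (m + 2)), dioph s x t ≤
        ∫ t in (2 * Q x (m + 1))..(2 * Q x (m + 2)), t ^ (-s) * (√2 / √(Q x (m + 1))) := by
      refine intervalIntegral.integral_mono_on (by linarith)
        (intervalIntegrable_dioph hs x (by linarith) (by linarith)) (hcont.mul_const _) fun t ht => ?_
      have ht0 : 0 < t := by linarith [ht.1]
      have h3 := half_Q_le_minDen hx (m + 1) ht.1
      rw [dioph, div_eq_mul_inv]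
      refine mul_le_mul_of_nonneg_left ?_ (by positivity)
      rw [← Real.sqrt_div (by norm_num), ← Real.sqrt_inv]
      refine Real.sqrt_le_sqrt ?_
      rw [← inv_div]
      exact inv_anti₀ (by linarith) h3
    rw [intervalIntegral.integral_mul_const] at h2
    refine h2.trans ((mul_le_mul_of_nonneg_right (hc m) (by positivity)).trans (le_of_eq ?_))
    ring
  have hc0 : ∀ m, 0 ≤ √2 * (c m / √(Q x (m + 1))) := by
    intro m
    refine le_trans ?_ (hpiece m)
    refine intervalIntegral.integral_nonneg
      (by linarith [Q_mono x (Nat.le_succ (m + 1))]) fun t ht => dioph_nonneg ?_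
    linarith [ht.1, hQ (m + 1)]
  have hsum2 := hsum.mul_left √2
  refine integrableOn_Ioi_of_intervalIntegral_norm_bounded (l := atTop)
    (b := fun n : ℕ => 2 * Q x (n + 1))
    ((∫ t in (1 / 2 : ℝ)..(2 * Q x (0 + 1)), dioph s x t) + ∑' m, √2 * (c m / √(Q x (m + 1))))
    (1 / 2) (fun n => ?_) ?_ (Eventually.of_forall fun n => ?_)
  · have := intervalIntegrable_dioph hs x (a := 1 / 2) (b := 2 * Q x (n + 1)) (by norm_num)
      (by linarith [hQ (n + 1)])
    exact this.1
  · exact ((tendsto_Q hx).comp (tendsto_add_atTop_nat 1)).const_mul_atTop (by norm_num)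
  · have hnorm : ∫ t in (1 / 2 : ℝ)..(2 * Q x (n + 1)), ‖dioph s x t‖ =
        ∫ t in (1 / 2 : ℝ)..(2 * Q x (n + 1)), dioph s x t := by
      refine intervalIntegral.integral_congr fun t ht => ?_
      rw [uIcc_of_le (by linarith [hQ (n + 1)])] at ht
      exact Real.norm_of_nonneg (dioph_nonneg (by linarith [ht.1]))
    rw [hnorm]
    have hadd : ∀ n : ℕ, ∫ t in (1 / 2 : ℝ)..(2 * Q x (n + 1)), dioph s x t ≤
        (∫ t in (1 / 2 : ℝ)..(2 * Q x (0 + 1)), dioph s x t) +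
          ∑ m ∈ Finset.range n, √2 * (c m / √(Q x (m + 1))) := by
      intro n
      induction n with
      | zero => simp
      | succ n ih =>
        rw [Finset.sum_range_succ, ← intervalIntegral.integral_add_adjacent_intervals
          (b := 2 * Q x (n + 1))
          (intervalIntegrable_dioph hs x (by norm_num) (by linarith [hQ (n + 1)]))
          (intervalIntegrable_dioph hs x (by linarith [hQ (n + 1)]) (by linarith [hQ (n + 1 + 1)])),
          ← add_assoc]
        exact add_le_add ih (hpiece n)
    refine (hadd n).trans ?_
    have := hsum2.sum_le_tsum (Finset.range n) fun m _ => hc0 m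
    linarith

/-- A piece contributes a constant times `Q_{n+1}^{1-s}/Q_n^{1/2}`. The term of (1) is this quantity
times `(Q_{n+1}/Q_n)^{(1+s)/2} ≥ 1`. -/
theorem integrableOn_dioph_of_summable {s x : ℝ} (hs : 0 < s) (hs1 : s < 1) (hx : Irrational x)
    (h : Summable fun n : ℕ => Q x (n + 2) ^ ((3 - s) / 2) / Q x (n + 1) ^ (1 + s / 2)) :
    IntegrableOn (dioph s x) (Ioi (1 / 2)) := by
  have hQ := one_le_Q hx
  refine integrableOn_dioph hs hx (c := fun m => (2 * Q x (m + 2)) ^ (1 - s) / (1 - s))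
    (fun m => ?_) ?_
  · have h1 : Q x (m + 1) ≤ Q x (m + 2) := Q_mono x (Nat.le_succ _)
    rw [integral_rpow (Or.inl (by linarith)), show -s + 1 = 1 - s by ring]
    refine div_le_div_of_nonneg_right ?_ (by linarith)
    have : 0 ≤ (2 * Q x (m + 1)) ^ (1 - s) := Real.rpow_nonneg (by linarith [hQ (m + 1)]) _
    linarith
  · refine Summable.of_nonneg_of_le (fun m => ?_) (fun m => ?_)
      (h.mul_left (2 ^ (1 - s) / (1 - s)))
    · have := hQ (m + 2)
      have : 0 < 1 - s := by linarith
      positivity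
    · have h1 : Q x (m + 1) ≤ Q x (m + 2) := Q_mono x (Nat.le_succ _)
      have hA := hQ (m + 1)
      have hB := hQ (m + 2)
      set A := Q x (m + 1)
      set B := Q x (m + 2)
      have hA0 : 0 < A := by linarith
      have hB0 : 0 < B := by linarith
      have hs' : 0 < 1 - s := by linarith
      rw [Real.mul_rpow (by norm_num) hB0.le, mul_div_right_comm, mul_div_assoc]
      refine mul_le_mul_of_nonneg_left ?_ (by positivity)
      rw [Real.sqrt_eq_rpow, div_le_div_iff₀ (by positivity) (by positivity),
        show (3 - s) / 2 = (1 - s) + (1 + s) / 2 by ring, Real.rpow_add hB0,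
        show 1 + s / 2 = (1 + s) / 2 + 1 / 2 by ring, Real.rpow_add hA0]
      have h2 : A ^ ((1 + s) / 2) ≤ B ^ ((1 + s) / 2) := Real.rpow_le_rpow hA0.le h1 (by linarith)
      have h3 : 0 ≤ B ^ (1 - s) * A ^ (1 / 2 : ℝ) := by positivity
      nlinarith

/-- For `s = 1` a piece contributes at most a constant times `log(Q_{n+1})/√Q_n`, which is at most
`log(Q_{n+1})/√Q_{n-1}`. -/
theorem integrableOn_dioph_one_of_summable {x : ℝ} (hx : Irrational x)
    (h : Summable fun n : ℕ => Real.log (Q x (n + 2)) / √(Q x n) +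
      Q x (n + 2) * Real.log (Q x (n + 2)) ^ 2 / Q x (n + 1) ^ (3 / 2 : ℝ)) :
    IntegrableOn (dioph 1 x) (Ioi (1 / 2)) := by
  have hQ := one_le_Q hx
  have hlog : ∀ n, 0 ≤ Real.log (Q x n) := fun n => Real.log_nonneg (hQ n)
  refine integrableOn_dioph one_pos hx (c := fun m => Real.log (Q x (m + 2)))
    (fun m => ?_) ?_
  · have h1 := hQ (m + 1)
    have h2 := hQ (m + 2)
    simp_rw [Real.rpow_neg_one]
    rw [integral_inv_of_pos (by linarith) (by linarith), mul_div_mul_left _ _ (by norm_num),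
      Real.log_div (by linarith) (by linarith)]
    linarith [hlog (m + 1)]
  · refine Summable.of_nonneg_of_le (fun m => div_nonneg (hlog _) (Real.sqrt_nonneg _))
      (fun m => ?_) h
    have h1 : Q x m ≤ Q x (m + 1) := Q_mono x (Nat.le_succ _)
    have h2 : Real.log (Q x (m + 2)) / √(Q x (m + 1)) ≤ Real.log (Q x (m + 2)) / √(Q x m) :=
      div_le_div_of_nonneg_left (hlog _) (Real.sqrt_pos.2 (by linarith [hQ m])) (Real.sqrt_le_sqrt h1)
    have h3 : 0 ≤ Q x (m + 2) * Real.log (Q x (m + 2)) ^ 2 / Q x (m + 1) ^ (3 / 2 : ℝ) := by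
      have := hQ (m + 2)
      have := hQ (m + 1)
      positivity
    linarith

/-! ### Consequences of a bound on the irrationality exponent. -/

/-- For an exponent `ν'` between `μ(x)` and `ν`, only finitely many denominators approximate to
order `ν'`. So for large `n` the error of the `n`-th convergent is at least `Q_n^{-ν'}`, while it is
at most `1/(Q_n Q_{n+1})`. -/
theorem exists_Q_succ_le {x ν : ℝ} (hx : Irrational x) (hν : 1 < ν)
    (h : irrationalityExponent x < (ν : EReal)) :
    ∃ ν' : ℝ, 1 ≤ ν' ∧ ν' < ν ∧ ∀ᶠ n in atTop, Q x (n + 1) ≤ Q x n ^ (ν' - 1) := by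
  obtain ⟨w, hw1, hw2⟩ := EReal.lt_iff_exists_real_btwn.1 h
  have hw2' : w < ν := by exact_mod_cast hw2
  -- The maximum with `1` is needed because only exponents at least `1` enter the supremum defining
  -- `μ(x)`.
  refine ⟨max w 1, le_max_right _ _, max_lt hw2' hν, ?_⟩
  set ν' := max w 1 with hν'
  have hfin : {q : ℕ | 1 ≤ q ∧ ∃ p : ℤ, |x - (p : ℝ) / q| < 1 / (q : ℝ) ^ ν'}.Finite := by
    by_contra hinf
    have h1 : ((ν' : ℝ) : EReal) ≤ irrationalityExponent x :=
      le_sSup ⟨ν', ⟨le_max_right _ _, hinf⟩, rfl⟩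
    have h2 : ((w : ℝ) : EReal) ≤ (ν' : EReal) := by exact_mod_cast le_max_left w 1
    exact absurd (h2.trans h1) (not_le.2 hw1)
  obtain ⟨B, hB⟩ := hfin.bddAbove
  filter_upwards [(tendsto_Q hx).eventually_gt_atTop (B : ℝ)] with n hn
  have hQ1 := one_le_Q hx n
  have hQ2 := one_le_Q hx (n + 1)
  obtain ⟨P, R, hP, hR⟩ := exists_int_num_den hx n
  have hR0 : 0 < R := by
    have : (0 : ℝ) < R := by linarith
    exact_mod_cast this
  have hRn : ((R.toNat : ℕ) : ℝ) = Q x n := by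
    rw [hR]; exact_mod_cast Int.toNat_of_nonneg hR0.le
  have h1 : 1 / Q x n ^ ν' ≤ |x - P / Q x n| := by
    by_contra hlt
    push Not at hlt
    have h2 : R.toNat ≤ B := hB ⟨by omega, P, by rw [hRn]; exact hlt⟩
    have h3 : ((R.toNat : ℕ) : ℝ) ≤ B := by exact_mod_cast h2
    linarith
  have h2 := abs_Q_mul_sub_le hx n
  rw [hP] at h2
  have h3 := h1.trans h2
  have hpos : 0 < Q x n ^ ν' := Real.rpow_pos_of_pos (by linarith) _
  rw [one_div_le_one_div hpos (by positivity)] at h3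
  rw [Real.rpow_sub_one (by linarith), le_div_iff₀ (by linarith)]
  linarith

theorem summable_of_irrationalityExponent_lt {s x : ℝ} (hs : 1 / 2 < s) (hs1 : s < 1)
    (hx : Irrational x)
    (h : irrationalityExponent x < ((1 + (2 + s) / (3 - s) : ℝ) : EReal)) :
    Summable fun n : ℕ => Q x (n + 2) ^ ((3 - s) / 2) / Q x (n + 1) ^ (1 + s / 2) := by
  have hQ := one_le_Q hx
  have h3s : 0 < 3 - s := by linarith
  obtain ⟨ν, hν1, hν, hev⟩ := exists_Q_succ_le hx (by
    have : 0 < (2 + s) / (3 - s) := by apply div_pos <;> linarith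
    linarith) h
  -- This exponent is positive exactly when `ν < 1 + (2 + s)/(3 - s)`, and the terms of (1) are
  -- eventually at most `Q_n` to minus it.
  have hη : 0 < (1 + s / 2) - (ν - 1) * ((3 - s) / 2) := by
    have h1 : ν - 1 < (2 + s) / (3 - s) := by linarith
    rw [lt_div_iff₀ h3s] at h1
    linarith
  refine Summable.of_norm_bounded_eventually_nat
    ((summable_nat_add_iff 1).2 (summable_Q_rpow hx hη)) ?_
  filter_upwards [(tendsto_add_atTop_nat 1).eventually hev] with n hn
  have hA : 0 < Q x (n + 1) := by linarith [hQ (n + 1)]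
  have hB : 0 < Q x (n + 2) := by linarith [hQ (n + 2)]
  rw [Real.norm_of_nonneg (by positivity)]
  have h1 : Q x (n + 2) ^ ((3 - s) / 2) ≤ Q x (n + 1) ^ ((ν - 1) * ((3 - s) / 2)) := by
    rw [Real.rpow_mul hA.le]
    exact Real.rpow_le_rpow hB.le hn (by linarith)
  refine (div_le_div_of_nonneg_right h1 (by positivity)).trans (le_of_eq ?_)
  rw [← Real.rpow_sub hA]
  congr 1; ring

theorem summable_one_of_irrationalityExponent_lt {x : ℝ} (hx : Irrational x)
    (h : irrationalityExponent x < ((5 / 2 : ℝ) : EReal)) :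
    Summable fun n : ℕ => Real.log (Q x (n + 2)) / √(Q x n) +
      Q x (n + 2) * Real.log (Q x (n + 2)) ^ 2 / Q x (n + 1) ^ (3 / 2 : ℝ) := by
  have hQ := one_le_Q hx
  have hQ0 : ∀ n, 0 < Q x n := fun n => by linarith [hQ n]
  have hlog : ∀ n, 0 ≤ Real.log (Q x n) := fun n => Real.log_nonneg (hQ n)
  obtain ⟨ν, hν1, hν, hev⟩ := exists_Q_succ_le hx (by norm_num) h
  -- Since `ν - 1 < 3/2`, logarithms grow by a factor of at most `3/2` per step. Two steps and `log
  -- t ≤ 4 t^{1/4}` give the constant `9 = (9/4) · 4` used below.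
  have hlogle : ∀ᶠ n in atTop, Real.log (Q x (n + 1)) ≤ 3 / 2 * Real.log (Q x n) := by
    filter_upwards [hev] with n hn
    have h1 := Real.log_le_log (hQ0 _) hn
    rw [Real.log_rpow (hQ0 n)] at h1
    nlinarith [hlog n]
  refine Summable.add ?_ ?_
  · refine Summable.of_norm_bounded_eventually_nat
      ((summable_Q_rpow hx (η := 1 / 4) (by norm_num)).mul_left 9) ?_
    filter_upwards [hlogle, (tendsto_add_atTop_nat 1).eventually hlogle] with n hn hn1
    rw [Real.norm_of_nonneg (div_nonneg (hlog _) (Real.sqrt_nonneg _)),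
      div_le_iff₀ (Real.sqrt_pos.2 (hQ0 n))]
    have h1 := Real.log_le_rpow_div (x := Q x n) (hQ0 n).le (ε := 1 / 4) (by norm_num)
    have h2 : Q x n ^ (-(1 / 4) : ℝ) * √(Q x n) = Q x n ^ (1 / 4 : ℝ) := by
      rw [Real.sqrt_eq_rpow, ← Real.rpow_add (hQ0 n)]; norm_num
    rw [mul_assoc, h2]
    have hn1' : Real.log (Q x (n + 2)) ≤ 3 / 2 * Real.log (Q x (n + 1)) := hn1
    linarith
  -- The margin `κ` is shared out: `Q_{n+1}` costs the exponent `ν - 1 = 3/2 - κ`, the squared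
  -- logarithm costs `κ/2`, and `-κ/2` remains after division by `Q_n^{3/2}`.
  · set κ : ℝ := 5 / 2 - ν with hκ
    have hκ0 : 0 < κ := by linarith
    refine Summable.of_norm_bounded_eventually_nat
      (((summable_nat_add_iff 1).2 (summable_Q_rpow hx (η := κ / 2) (by linarith))).mul_left
        (9 / 4 * (1 / (κ / 4)) ^ 2)) ?_
    filter_upwards [(tendsto_add_atTop_nat 1).eventually hlogle,
      (tendsto_add_atTop_nat 1).eventually hev] with n hn1 hn2
    have hn1' : Real.log (Q x (n + 2)) ≤ 3 / 2 * Real.log (Q x (n + 1)) := hn1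
    have hn2' : Q x (n + 2) ≤ Q x (n + 1) ^ (ν - 1) := hn2
    have hA0 := hQ0 (n + 1)
    have hB0 := hQ0 (n + 2)
    have hlB := hlog (n + 2)
    have h1 := Real.log_le_rpow_div (x := Q x (n + 1)) hA0.le (ε := κ / 4) (by linarith)
    set A := Q x (n + 1)
    rw [Real.norm_of_nonneg (by positivity), div_le_iff₀ (by positivity)]
    have h2 : Real.log (Q x (n + 2)) ^ 2 ≤ (3 / 2 * (A ^ (κ / 4) / (κ / 4))) ^ 2 :=
      pow_le_pow_left₀ hlB (by linarith) 2
    calc Q x (n + 2) * Real.log (Q x (n + 2)) ^ 2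
        ≤ A ^ (ν - 1) * (3 / 2 * (A ^ (κ / 4) / (κ / 4))) ^ 2 := by gcongr
      _ = 9 / 4 * (1 / (κ / 4)) ^ 2 * (A ^ (ν - 1) * (A ^ (κ / 4) * A ^ (κ / 4))) := by ring
      _ = 9 / 4 * (1 / (κ / 4)) ^ 2 * (A ^ (-(κ / 2)) * A ^ (3 / 2 : ℝ)) := by
        rw [← Real.rpow_add hA0, ← Real.rpow_add hA0, ← Real.rpow_add hA0, hκ]
        congr 2; ring
      _ = _ := by ring

end ThetaSeries

theorem corollary4 :
    (∀ s : ℝ, 1 / 2 < s → s < 1 →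
      (∀ x : ℝ, Irrational x → x ∈ Set.Ioo (-1 : ℝ) 1 →
        Summable (fun n : ℕ =>
          ThetaSeries.Q x (n + 2) ^ ((3 - s) / 2) / ThetaSeries.Q x (n + 1) ^ (1 + s / 2)) →
        ThetaSeries.FEqualsSeries s x (fun j : ℕ =>
          ThetaSeries.phase x j * ((ThetaSeries.absProd x j ^ (s - 1 / 2) : ℝ) : ℂ) *
            ThetaSeries.Omega s (ThetaSeries.T^[j] x))) ∧
      (∀ x : ℝ, Irrational x →
        ThetaSeries.irrationalityExponent x < ((1 + (2 + s) / (3 - s) : ℝ) : EReal) →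
        Summable (fun n : ℕ =>
          ThetaSeries.Q x (n + 2) ^ ((3 - s) / 2) / ThetaSeries.Q x (n + 1) ^ (1 + s / 2)))) ∧
    ((∀ x : ℝ, Irrational x → x ∈ Set.Ioo (-1 : ℝ) 1 →
        Summable (fun n : ℕ =>
          Real.log (ThetaSeries.Q x (n + 2)) / √(ThetaSeries.Q x n) +
            ThetaSeries.Q x (n + 2) * Real.log (ThetaSeries.Q x (n + 2)) ^ 2 /
              ThetaSeries.Q x (n + 1) ^ (3 / 2 : ℝ)) →
        ThetaSeries.FEqualsSeries 1 x (fun j : ℕ =>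
          ThetaSeries.phase x j * ((√(ThetaSeries.absProd x j) : ℝ) : ℂ) *
            ThetaSeries.Omega 1 (ThetaSeries.T^[j] x))) ∧
      (∀ x : ℝ, Irrational x →
        ThetaSeries.irrationalityExponent x < ((5 / 2 : ℝ) : EReal) →
        Summable (fun n : ℕ =>
          Real.log (ThetaSeries.Q x (n + 2)) / √(ThetaSeries.Q x n) +
            ThetaSeries.Q x (n + 2) * Real.log (ThetaSeries.Q x (n + 2)) ^ 2 /
              ThetaSeries.Q x (n + 1) ^ (3 / 2 : ℝ)))) := by
  refine ⟨fun s hs hs1 => ⟨fun x hx hx1 h => ?_, fun x hx h =>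
    ThetaSeries.summable_of_irrationalityExponent_lt hs hs1 hx h⟩, fun x hx hx1 h => ?_,
    fun x hx h => ThetaSeries.summable_one_of_irrationalityExponent_lt hx h⟩
  · exact ThetaSeries.FEqualsSeries_of_integrable hs hs1.le hx (abs_lt.2 hx1)
      (ThetaSeries.integrableOn_dioph_of_summable (by linarith) hs1 hx h)
      (ThetaSeries.tendsto_minDen hx)
  · have := ThetaSeries.FEqualsSeries_of_integrable (s := 1) (by norm_num) le_rfl hx (abs_lt.2 hx1)
      (ThetaSeries.integrableOn_dioph_one_of_summable hx h) (ThetaSeries.tendsto_minDen hx)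
    simp_rw [Real.sqrt_eq_rpow]
    norm_num at this ⊢
    exact this

end
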